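/- **Setting.** Let $n\ge 2$, let $\mathcal G=(V,E)$, $V=[n]$, be a connected, non-bipartite (simple, undirected) graph, and let $(p_e)_{e\in E}$ be a probability distribution on $E$ with $p_e>0$ for every $e\in E$. Let $\alpha\in(0,1/2)$, $m=\lfloor\alpha n\rfloor$, and let $X=(X_1,\dots,X_n)\in\mathbb R^n$ have pairwise distinct entries, with ranks $r_k=1+\#\{l: X_k>X_l\}$ and $\alpha$-trimmed mean $$\bar x_\alpha=\frac1{n-2m}\sum_{k:\ m+1\le r_k\le n-m}X_k .$$ Put $a=m+\tfrac12$, $b=n-m+\tfrac12$ and $w_{n,\alpha}(x)=\mathbb I_{\{a\le x\le b\}}/(1-2m/n)$. **Adaptive GoTrim.** Initialize $Y_k=X_k$, $R'_k=0$, $C_k=1$, $W_k=N_k=M_k=0$ for all $k$. At each iteration draw, independently of the past, an edge $e=\{i,j\}\in E$ with probability $p_e$. For each active node $k$ (asynchronous version: $k\in\{i,j\}$; synchronous version: all $k\in[n]$) set $R'_k\leftarrow(1-1/C_k)R'_k+(1/C_k)\mathbb I_{\{X_k>Y_k\}}$, $C_k\leftarrow C_k+1$, $W'_k\leftarrow w_{n,\alpha}(nR'_k+1)$,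 $N_k\leftarrow N_k+(W'_k-W_k)X_k$, $M_k\leftarrow M_k+(W'_k-W_k)$, $W_k\leftarrow W'_k$. Then replace $N_i,N_j$ by $(N_i+N_j)/2$ and $M_i,M_j$ by $(M_i+M_j)/2$, and swap $Y_i\leftrightarrow Y_j$. After $t$ iterations the estimate is $Z_k(t)=N_k(t)/\max(1,M_k(t))$. **Constants.** With $L_e=(\mathbf e_i-\mathbf e_j)(\mathbf e_i-\mathbf e_j)^\top$ for $e=\{i,j\}$, let $c$ be the second smallest eigenvalue of $\sum_{e\in E}p_eL_e$, let $\lambda_2(2)$ be the second largest eigenvalue of $I_n-\frac12\sum_{e\in E}p_eL_e$, and $\tilde c=1-\sqrt{\lambda_2(2)}$. Let $\mathbf K=(K_k)_{k\in[n]}$ with $$K_k=\frac{\sqrt6\,\sigma_n(r_k)}{\gamma_k(1-2\alpha)},\quad \sigma_n(r)=n^{3/2}\sqrt{\tfrac{r-1}n\left(1-\tfrac{r-1}n\right)},\quad \gamma_k=\min(|r_k-a|,|r_k-b|).$$ Let $\odot$ be the entrywise product, $|X|=(|X_1|,\dots,|X_n|)$, and $\|\cdot\|=\|\cdot\|_2$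 the Euclidean norm. **Theorem 4.** There is an absolute constant $C>0$ such that in the above setting, for the asynchronous as well as the synchronous version of Adaptive GoTrim: 1. There is $T^*>0$ such that for every integer $t>T^*$ $$\mathbb E\,\|Z(t)-\bar x_\alpha\mathbf 1_n\|_2\le\frac{C}{\tilde c\sqrt{ct}}\,\big\|\mathbf K\odot(X+|\bar x_\alpha|\mathbf 1_n)\big\| .$$ 2. There is $T^*>0$, depending only on the graph, on $(p_e)_{e\in E}$ and on the version of the algorithm, and not on $\alpha$ or $X$, such that for all $\alpha\in(0,1/2)$, all $X$ with pairwise distinct entries and every integer $t>T^*$ $$\mathbb E\,\|Z(t)-\bar x_\alpha\mathbf 1_n\|_2\le\frac{C}{\tilde c\sqrt{ct}}\,\big\|\mathbf K\odot(|X|+|\bar x_\alpha|\mathbf 1_n)\big\| .$$ -/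

import Mathlib

namespace GoTrim

noncomputable section

open MeasureTheory ProbabilityTheory

variable {n : ℕ}

/-! ### Edge sampling and the weighted graph Laplacian -/

/-- The transposition of the two endpoints of an (unordered) edge. -/
def edgeSwap : Sym2 (Fin n) → Equiv.Perm (Fin n) :=
  Sym2.lift ⟨fun i j => Equiv.swap i j, fun i j => Equiv.swap_comm i j⟩

/-- The elementary Laplacian `(e_i - e_j) (e_i - e_j)ᵀ` of the edge `{i, j}`. -/
def edgeLaplacian : Sym2 (Fin n) → Matrix (Fin n) (Fin n) ℝ :=
  Sym2.lift ⟨fun i j => Matrix.vecMulVec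
      (Pi.single i (1 : ℝ) - Pi.single j 1) (Pi.single i 1 - Pi.single j 1), fun i j => by
    ext a b
    simp only [Matrix.vecMulVec_apply, Pi.sub_apply]
    ring⟩

/-- `p` is a probability distribution on the edges of `G` that charges every edge. -/
structure IsEdgeLaw (G : SimpleGraph (Fin n)) (p : Sym2 (Fin n) → ℝ) : Prop where
  pos : ∀ e ∈ G.edgeSet, 0 < p e
  zero : ∀ e, e ∉ G.edgeSet → p e = 0
  sum_eq_one : ∑ e, p e = 1

/-- The random edges `e 0, e 1, …` are independent, each with distribution `p`. -/
structure IsEdgeSampling {Ω : Type*} [MeasurableSpace Ω] (μ : Measure Ω)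
    (p : Sym2 (Fin n) → ℝ) (e : ℕ → Ω → Sym2 (Fin n)) : Prop where
  measurable : ∀ t, Measurable[_, ⊤] (e t)
  indep : iIndepFun (m := fun _ => ⊤) e μ
  law : ∀ t x, μ (e t ⁻¹' {x}) = ENNReal.ofReal (p x)

/-- The weighted Laplacian `L(P) = ∑ₑ pₑ Lₑ` (terms outside the edge set vanish since
there `pₑ = 0`). -/
def weightedLaplacian (p : Sym2 (Fin n) → ℝ) : Matrix (Fin n) (Fin n) ℝ :=
  ∑ e, p e • edgeLaplacian e

/-- The expected averaging matrix `W₂ = I - (1/2) ∑ₑ pₑ Lₑ`. -/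
def meanAveraging (p : Sym2 (Fin n) → ℝ) : Matrix (Fin n) (Fin n) ℝ :=
  1 - (1 / 2 : ℝ) • weightedLaplacian p

theorem edgeLaplacian_isHermitian (e : Sym2 (Fin n)) : (edgeLaplacian e).IsHermitian := by
  induction e using Sym2.ind with
  | _ i j =>
    ext a b
    simp [edgeLaplacian, Matrix.vecMulVec_apply, mul_comm]

theorem weightedLaplacian_isHermitian (p : Sym2 (Fin n) → ℝ) :
    (weightedLaplacian p).IsHermitian := by
  unfold weightedLaplacian Matrix.IsHermitian
  rw [Matrix.conjTranspose_sum]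
  refine Finset.sum_congr rfl fun e _ => ?_
  rw [Matrix.conjTranspose_smul, (edgeLaplacian_isHermitian e).eq, star_trivial]

theorem meanAveraging_isHermitian (p : Sym2 (Fin n) → ℝ) :
    (meanAveraging p).IsHermitian := by
  unfold meanAveraging Matrix.IsHermitian
  rw [Matrix.conjTranspose_sub, Matrix.conjTranspose_one, Matrix.conjTranspose_smul,
    (weightedLaplacian_isHermitian p).eq, star_trivial]

/-- The spectral gap `c`: the second smallest eigenvalue of `L(P)`, with multiplicity
(`eigenvalues₀` lists the eigenvalues in decreasing order). -/
def spectralGap (hn : 2 ≤ n) (p : Sym2 (Fin n) → ℝ) : ℝ :=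
  (weightedLaplacian_isHermitian p).eigenvalues₀ ⟨n - 2, by rw [Fintype.card_fin]; omega⟩

/-- `λ₂(2)`: the second largest eigenvalue of `W₂`, with multiplicity. -/
def lambdaTwo (hn : 2 ≤ n) (p : Sym2 (Fin n) → ℝ) : ℝ :=
  (meanAveraging_isHermitian p).eigenvalues₀ ⟨1, by rw [Fintype.card_fin]; omega⟩

/-- `c̃ = 1 - √λ₂(2)`. -/
def cTilde (hn : 2 ≤ n) (p : Sym2 (Fin n) → ℝ) : ℝ := 1 - √(lambdaTwo hn p)

/-! ### Ranks, trimming weights and the trimmed mean -/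

/-- The rank `r_k = 1 + #{l : X_k > X_l}`. -/
def rank (X : Fin n → ℝ) (k : Fin n) : ℕ := 1 + (Finset.univ.filter fun l => X l < X k).card

/-- The number `m = ⌊α n⌋` of observations trimmed on each side. -/
def trimCount (n : ℕ) (α : ℝ) : ℕ := ⌊α * n⌋₊

/-- The `α`-trimmed mean: the average of the observations of rank in `[m + 1, n - m]`. -/
def trimmedMean (α : ℝ) (X : Fin n → ℝ) : ℝ :=
  ∑ k, if trimCount n α + 1 ≤ rank X k ∧ rank X k + trimCount n α ≤ n
    then X k / ((n : ℝ) - 2 * trimCount n α) else 0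

/-- Left endpoint `a = ⌊α n⌋ + 1/2` of the inclusion interval. -/
def leftEnd (n : ℕ) (α : ℝ) : ℝ := trimCount n α + 1 / 2

/-- Right endpoint `b = n - ⌊α n⌋ + 1/2` of the inclusion interval. -/
def rightEnd (n : ℕ) (α : ℝ) : ℝ := n - trimCount n α + 1 / 2

open Classical in
/-- The weight `w_{n,α}(x) = 𝟙{x ∈ [a, b]} / (1 - 2 m / n)` of an estimated rank `x`. -/
def weight (n : ℕ) (α x : ℝ) : ℝ :=
  if x ∈ Set.Icc (leftEnd n α) (rightEnd n α) then 1 / (1 - 2 * trimCount n α / n) else 0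

/-- `σ_n(r) = n^{3/2} φ((r - 1) / n)` with `φ(u) = √(u (1 - u))`. -/
def sigma (n : ℕ) (r : ℝ) : ℝ := (n : ℝ) ^ (3 / 2 : ℝ) * √((r - 1) / n * (1 - (r - 1) / n))

/-- `γ_k = min(|r_k - a|, |r_k - b|)`. -/
def gamma (α : ℝ) (X : Fin n → ℝ) (k : Fin n) : ℝ :=
  min |(rank X k : ℝ) - leftEnd n α| |(rank X k : ℝ) - rightEnd n α|

/-- The vector `K` with entries `√6 σ_n(r_k) / (γ_k (1 - 2 α))`. -/
def kVec (α : ℝ) (X : Fin n → ℝ) (k : Fin n) : ℝ :=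
  √6 * sigma n (rank X k) / (gamma α X k * (1 - 2 * α))

/-! ### The algorithm -/

/-- Which nodes refresh their rank estimate and weight at an iteration: all nodes
(synchronous), or only the two endpoints of the drawn edge (asynchronous). -/
inductive Schedule
  | synchronous
  | asynchronous

/-- Node `k` is refreshed when edge `e` is drawn. -/
def Schedule.Active : Schedule → Sym2 (Fin n) → Fin n → Prop
  | .synchronous, _, _ => True
  | .asynchronous, e, k => k ∈ e

/-- The local variables of all nodes. -/
structure State (n : ℕ) where
  /-- auxiliary observation `Y_k` -/
  aux : Fin n → ℝ
  /-- normalized rank estimate `R'_k` -/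
  normRank : Fin n → ℝ
  /-- counter `C_k` (one plus the number of refreshments of node `k` so far) -/
  count : Fin n → ℕ
  /-- weight `W_k` -/
  wt : Fin n → ℝ
  /-- numerator `N_k` -/
  num : Fin n → ℝ
  /-- estimate `M_k` of the average weight -/
  mass : Fin n → ℝ

/-- Initialization: `Y = X`, `R' = 0`, `C = 1`, `W = N = M = 0`. -/
def State.init (X : Fin n → ℝ) : State n :=
  ⟨X, fun _ => 0, fun _ => 1, fun _ => 0, fun _ => 0, fun _ => 0⟩

/-- Averaging of a vector along an edge: both endpoints take the mean of their values. -/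
def average (e : Sym2 (Fin n)) (v : Fin n → ℝ) (k : Fin n) : ℝ :=
  if k ∈ e then (v k + v (edgeSwap e k)) / 2 else v k

open Classical in
/-- One iteration of Adaptive GoTrim (with GoRank as ranking algorithm) when edge `e` is drawn:
active nodes refresh `R'`, the rank estimate `R = n R' + 1`, the weight, `N` and `M`; then the
endpoints of `e` average `N` and `M` and swap their auxiliary observations. -/
def step (mode : Schedule) (α : ℝ) (X : Fin n → ℝ) (s : State n) (e : Sym2 (Fin n)) : State n :=
  let R' : Fin n → ℝ := fun k =>
    if mode.Active e k then
      (1 - 1 / (s.count k : ℝ)) * s.normRank k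
        + (1 / (s.count k : ℝ)) * (if s.aux k < X k then 1 else 0)
    else s.normRank k
  let W' : Fin n → ℝ := fun k =>
    if mode.Active e k then weight n α (n * R' k + 1) else s.wt k
  { aux := fun k => s.aux (edgeSwap e k)
    normRank := R'
    count := fun k => if mode.Active e k then s.count k + 1 else s.count k
    wt := W'
    num := average e fun k => s.num k + (W' k - s.wt k) * X k
    mass := average e fun k => s.mass k + (W' k - s.wt k) }

/-- The state after `t` iterations along the edge sequence `e 0, e 1, …`. -/
def run (mode : Schedule) (α : ℝ) (X : Fin n → ℝ) (e : ℕ → Sym2 (Fin n)) : ℕ → State n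
  | 0 => State.init X
  | t + 1 => step mode α X (run mode α X e t) (e t)

/-- The Adaptive GoTrim estimate `Z_k(t) = N_k(t) / max(1, M_k(t))`. -/
def estimate (mode : Schedule) (α : ℝ) (X : Fin n → ℝ) (e : ℕ → Sym2 (Fin n)) (t : ℕ)
    (k : Fin n) : ℝ :=
  (run mode α X e t).num k / max 1 ((run mode α X e t).mass k)

/-- The Euclidean norm of a vector. -/
def l2norm (v : Fin n → ℝ) : ℝ := ‖WithLp.toLp 2 v‖

end

end GoTrim

/-!
A node's weight can be wrong only while `n` times its running rank estimate is off by at least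
`1 / 2`. The accumulated estimation error fluctuates with the random positions of the observations;
adding the linear functional given by a solution of the Poisson equation `L(P) u = e_k - 1 / n`
cancels this fluctuation in mean, and once the tolerance is subtracted a constant negative drift
remains. Its exponential moments, hence the mean squared weight errors, decay geometrically,
uniformly in the data. The numerators and masses track the averages of the weighted observations
and of the weights, and gossip contracts their dispersion by a constant factor in mean, so the
expected error of the estimates also decays geometrically, at a rate depending only on the graph,
the law and the schedule. This eventually beats every multiple of `1 / √t`. In the uniform bound the
right-hand side dominates the relevant data because every entry of `K` is at least `1 / n`, except
the vanishing one at rank one: a trimmed observation of rank one never gets a positive weight, and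
without trimming it is determined by the others and the mean.
-/

namespace GoTrim

noncomputable section

open MeasureTheory ProbabilityTheory
open scoped BigOperators Matrix

variable {n : ℕ}

/-! ### Dispersion of a vector -/

section Dispersion

variable {ι : Type*} [Fintype ι]

/-- The sum of squared deviations from the mean: the disagreement which gossip averaging reduces. -/
def dispersion (w : ι → ℝ) : ℝ := ∑ k, (w k - 𝔼 i, w i) ^ 2

theorem sum_sub_sq_eq (w : ι → ℝ) (c : ℝ) :
    ∑ k, (w k - c) ^ 2 = dispersion w + Fintype.card ι * (𝔼 i, w i - c) ^ 2 := by
  set m := 𝔼 i, w i with hm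
  have hcentered : ∑ k, (w k - m) = 0 := by
    rw [Finset.sum_sub_distrib, ← Fintype.card_mul_expect, Finset.sum_const, nsmul_eq_mul,
      Finset.card_univ, hm, sub_self]
  calc ∑ k, (w k - c) ^ 2
      = ∑ k, ((w k - m) ^ 2 + 2 * (m - c) * (w k - m) + (m - c) ^ 2) :=
        Finset.sum_congr rfl fun k _ => by ring
    _ = dispersion w + Fintype.card ι * (m - c) ^ 2 := by
        rw [Finset.sum_add_distrib, Finset.sum_add_distrib, ← Finset.mul_sum, hcentered, mul_zero,
          add_zero, Finset.sum_const, nsmul_eq_mul, Finset.card_univ, dispersion]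

theorem dispersion_le_sum_sq (w : ι → ℝ) : dispersion w ≤ ∑ k, w k ^ 2 := by
  have h := sum_sub_sq_eq w 0
  simp only [sub_zero] at h
  rw [h]
  exact le_add_of_nonneg_right (by positivity)

theorem card_mul_sq_expect_le (w : ι → ℝ) :
    Fintype.card ι * (𝔼 i, w i) ^ 2 ≤ ∑ k, w k ^ 2 := by
  have h := sum_sub_sq_eq w 0
  simp only [sub_zero] at h
  rw [h]
  exact le_add_of_nonneg_left (Finset.sum_nonneg fun _ _ => sq_nonneg _)

theorem add_sq_le_of_pos {η : ℝ} (hη : 0 < η) (a b : ℝ) :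
    (a + b) ^ 2 ≤ (1 + η) * a ^ 2 + (1 + 1 / η) * b ^ 2 := by
  have h : (1 + η) * a ^ 2 + (1 + 1 / η) * b ^ 2 - (a + b) ^ 2 = (η * a - b) ^ 2 / η := by
    field_simp
    ring
  linarith [div_nonneg (sq_nonneg (η * a - b)) hη.le]

theorem dispersion_add_le {η : ℝ} (hη : 0 < η) (v w : ι → ℝ) :
    dispersion (v + w) ≤ (1 + η) * dispersion v + (1 + 1 / η) * dispersion w := by
  simp only [dispersion, Finset.mul_sum, ← Finset.sum_add_distrib, Pi.add_apply,
    Finset.expect_add_distrib, add_sub_add_comm]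
  exact Finset.sum_le_sum fun k _ => add_sq_le_of_pos hη _ _

end Dispersion

/-! ### The weighted graph Laplacian -/

theorem edgeSwap_of_notMem {e : Sym2 (Fin n)} {k : Fin n} (hk : k ∉ e) : edgeSwap e k = k := by
  induction e with
  | _ i j =>
    rw [Sym2.mem_iff, not_or] at hk
    exact Equiv.swap_apply_of_ne_of_ne hk.1 hk.2

theorem average_eq (e : Sym2 (Fin n)) (v : Fin n → ℝ) (k : Fin n) :
    average e v k = (v k + v (edgeSwap e k)) / 2 := by
  unfold average
  split_ifs with h
  · rfl
  · rw [edgeSwap_of_notMem h, add_self_div_two]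

theorem average_add (e : Sym2 (Fin n)) (v w : Fin n → ℝ) :
    average e (v + w) = average e v + average e w := by
  ext k
  simp only [average_eq, Pi.add_apply]
  ring

theorem sum_average (e : Sym2 (Fin n)) (v : Fin n → ℝ) : ∑ k, average e v k = ∑ k, v k := by
  simp only [average_eq, ← Finset.sum_div, Finset.sum_add_distrib, Equiv.sum_comp,
    add_self_div_two]

theorem edgeLaplacian_mulVec (e : Sym2 (Fin n)) (v : Fin n → ℝ) :
    edgeLaplacian e *ᵥ v = v - v ∘ edgeSwap e := by
  induction e with
  | _ i j =>
    ext k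
    have h : (edgeLaplacian s(i, j) *ᵥ v) k =
        (v i - v j) * ((Pi.single i 1 : Fin n → ℝ) k - (Pi.single j 1 : Fin n → ℝ) k) := by
      change (Matrix.vecMulVec _ _ *ᵥ v) k = _
      simp [Matrix.vecMulVec_mulVec, sub_dotProduct, mul_comm]
    have hswap : edgeSwap s(i, j) k = if k = i then j else if k = j then i else k :=
      Equiv.swap_apply_def i j k
    simp only [h, Pi.single_apply, Pi.sub_apply, Function.comp_apply, hswap]
    split_ifs <;> subst_vars <;> simp

theorem edgeLaplacian_posSemidef (e : Sym2 (Fin n)) : (edgeLaplacian e).PosSemidef := by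
  induction e with
  | _ i j => exact Matrix.posSemidef_vecMulVec_self_star (Pi.single i 1 - Pi.single j 1 : Fin n → ℝ)

theorem dotProduct_edgeLaplacian_mk_mulVec (i j : Fin n) (v : Fin n → ℝ) :
    v ⬝ᵥ edgeLaplacian s(i, j) *ᵥ v = (v i - v j) ^ 2 := by
  change v ⬝ᵥ Matrix.vecMulVec _ _ *ᵥ v = _
  simp [Matrix.vecMulVec_mulVec, sub_dotProduct, dotProduct_sub, sq]

theorem dotProduct_edgeLaplacian_mulVec (e : Sym2 (Fin n)) (v : Fin n → ℝ) :
    v ⬝ᵥ edgeLaplacian e *ᵥ v = (∑ k, (v k - v (edgeSwap e k)) ^ 2) / 2 := by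
  have h := Equiv.sum_comp (edgeSwap e) fun k => v k ^ 2
  simp only [edgeLaplacian_mulVec, dotProduct, Pi.sub_apply, Function.comp_apply, sub_sq, mul_sub,
    Finset.sum_add_distrib, Finset.sum_sub_distrib, h, mul_assoc, ← Finset.mul_sum, ← sq]
  ring

theorem weightedLaplacian_mulVec (p : Sym2 (Fin n) → ℝ) (v : Fin n → ℝ) :
    weightedLaplacian p *ᵥ v = ∑ e, p e • (v - v ∘ edgeSwap e) := by
  simp only [weightedLaplacian, Matrix.sum_mulVec, Matrix.smul_mulVec, edgeLaplacian_mulVec]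

theorem dotProduct_weightedLaplacian_mulVec (p : Sym2 (Fin n) → ℝ) (v w : Fin n → ℝ) :
    v ⬝ᵥ weightedLaplacian p *ᵥ w = ∑ e, p e * (v ⬝ᵥ edgeLaplacian e *ᵥ w) := by
  simp only [weightedLaplacian, Matrix.sum_mulVec, Matrix.smul_mulVec, dotProduct_sum,
    dotProduct_smul, smul_eq_mul]

theorem weightedLaplacian_mulVec_dotProduct (p : Sym2 (Fin n) → ℝ) (v w : Fin n → ℝ) :
    weightedLaplacian p *ᵥ v ⬝ᵥ w = v ⬝ᵥ weightedLaplacian p *ᵥ w := by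
  have hsymm : (weightedLaplacian p)ᵀ = weightedLaplacian p := weightedLaplacian_isHermitian p
  rw [Matrix.dotProduct_mulVec, ← Matrix.mulVec_transpose, hsymm]

theorem sum_weightedLaplacian_mulVec (p : Sym2 (Fin n) → ℝ) (v : Fin n → ℝ) :
    ∑ k, (weightedLaplacian p *ᵥ v) k = 0 := by
  simp only [weightedLaplacian_mulVec, Finset.sum_apply, Pi.smul_apply, Pi.sub_apply,
    Function.comp_apply, smul_eq_mul]
  rw [Finset.sum_comm]
  simp only [← Finset.mul_sum, Finset.sum_sub_distrib, Equiv.sum_comp, sub_self, mul_zero,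
    Finset.sum_const_zero]

theorem weightedLaplacian_posSemidef {p : Sym2 (Fin n) → ℝ} (hp : ∀ e, 0 ≤ p e) :
    (weightedLaplacian p).PosSemidef :=
  Matrix.posSemidef_sum _ fun e _ => (edgeLaplacian_posSemidef e).smul (hp e)

theorem IsEdgeLaw.nonneg {G : SimpleGraph (Fin n)} {p : Sym2 (Fin n) → ℝ} (hp : IsEdgeLaw G p)
    (e : Sym2 (Fin n)) : 0 ≤ p e := by
  by_cases h : e ∈ G.edgeSet
  · exact (hp.pos e h).le
  · exact (hp.zero e h).ge

theorem IsEdgeLaw.mem_stdSimplex {G : SimpleGraph (Fin n)} {p : Sym2 (Fin n) → ℝ}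
    (hp : IsEdgeLaw G p) : p ∈ stdSimplex ℝ (Sym2 (Fin n)) :=
  ⟨hp.nonneg, hp.sum_eq_one⟩

section Connected

variable {G : SimpleGraph (Fin n)} {p : Sym2 (Fin n) → ℝ}

theorem eq_of_dotProduct_weightedLaplacian_nonpos (hG : G.Connected) (hp : IsEdgeLaw G p)
    {v : Fin n → ℝ} (hv : v ⬝ᵥ weightedLaplacian p *ᵥ v ≤ 0) (i j : Fin n) : v i = v j := by
  have hnonneg : ∀ e, 0 ≤ p e * (v ⬝ᵥ edgeLaplacian e *ᵥ v) := fun e =>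
    mul_nonneg (hp.nonneg e) ((edgeLaplacian_posSemidef e).dotProduct_mulVec_nonneg v)
  rw [dotProduct_weightedLaplacian_mulVec] at hv
  have hadj : ∀ i j, G.Adj i j → v i = v j := fun i j hij => by
    have h := (Finset.sum_eq_zero_iff_of_nonneg fun e _ => hnonneg e).1
      (hv.antisymm (Finset.sum_nonneg fun e _ => hnonneg e)) s(i, j) (Finset.mem_univ _)
    rw [dotProduct_edgeLaplacian_mk_mulVec] at h
    have hsq := (mul_eq_zero.1 h).resolve_left (hp.pos s(i, j) hij).ne'
    exact sub_eq_zero.1 (pow_eq_zero_iff two_ne_zero |>.1 hsq)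
  obtain ⟨walk⟩ := hG.preconnected i j
  induction walk with
  | nil => rfl
  | cons h _ ih => exact (hadj _ _ h).trans ih

theorem injective_weightedLaplacian_add_ones (hG : G.Connected) (hp : IsEdgeLaw G p) :
    Function.Injective (weightedLaplacian p + Matrix.of fun _ _ => 1).mulVec := by
  refine (injective_iff_map_eq_zero (Matrix.mulVecLin _)).2 fun v hv => ?_
  have hones : (Matrix.of fun _ _ => 1 : Matrix (Fin n) (Fin n) ℝ) *ᵥ v = fun _ => ∑ i, v i := by
    ext k
    simp [Matrix.mulVec, dotProduct]
  rw [Matrix.mulVecLin_apply, Matrix.add_mulVec, hones] at hv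
  have henergy : v ⬝ᵥ weightedLaplacian p *ᵥ v + (∑ i, v i) ^ 2 = 0 := by
    have h := congrArg (v ⬝ᵥ ·) hv
    simpa [dotProduct, mul_add, Finset.sum_add_distrib, ← Finset.sum_mul, sq] using h
  have hsum : ∑ i, v i = 0 := by
    have h := (weightedLaplacian_posSemidef hp.nonneg).dotProduct_mulVec_nonneg v
    rw [star_trivial] at h
    nlinarith
  have hconst := eq_of_dotProduct_weightedLaplacian_nonpos hG hp (v := v) (by nlinarith)
  ext k
  have hn : (n : ℝ) ≠ 0 := Nat.cast_ne_zero.2 k.pos.ne'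
  rw [Finset.sum_congr rfl fun i _ => hconst i k] at hsum
  simpa [hn] using hsum

theorem exists_weightedLaplacian_mulVec_eq (hG : G.Connected) (hp : IsEdgeLaw G p) (k : Fin n) :
    ∃ v : Fin n → ℝ, weightedLaplacian p *ᵥ v = Pi.single k 1 - Function.const _ (1 / n : ℝ) := by
  obtain ⟨v, hv⟩ := Matrix.mulVec_surjective_iff_isUnit.2
    (Matrix.mulVec_injective_iff_isUnit.1 (injective_weightedLaplacian_add_ones hG hp))
    (Pi.single k 1)
  have hn : (n : ℝ) ≠ 0 := Nat.cast_ne_zero.2 k.pos.ne'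
  have hv' : ∀ j, (weightedLaplacian p *ᵥ v) j + ∑ i, v i = (Pi.single k 1 : Fin n → ℝ) j :=
    fun j => by
      rw [← hv, Matrix.add_mulVec]
      simp [Matrix.mulVec, dotProduct]
  have hsum : ∑ i, v i = 1 / n := by
    have h := Finset.sum_congr rfl fun j (_ : j ∈ Finset.univ) => hv' j
    rw [Finset.sum_add_distrib, sum_weightedLaplacian_mulVec] at h
    rw [eq_div_iff hn, mul_comm]
    simpa using h
  refine ⟨v, funext fun j => ?_⟩
  rw [Pi.sub_apply, Function.const_apply, ← hv' j, hsum, add_sub_cancel_right]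

end Connected

theorem sq_dotProduct_mulVec_le {ι : Type*} [Fintype ι] {A : Matrix ι ι ℝ}
    (hA : A.PosSemidef) (v w : ι → ℝ) :
    (v ⬝ᵥ A *ᵥ w) ^ 2 ≤ (v ⬝ᵥ A *ᵥ v) * (w ⬝ᵥ A *ᵥ w) := by
  classical
  have hsymm : A.IsSymm := hA.isHermitian
  have h := LinearMap.BilinForm.apply_sq_le_of_symm (Matrix.toBilin' A)
    (fun x => by simpa [Matrix.toBilin'_apply'] using hA.dotProduct_mulVec_nonneg x)
    (LinearMap.BilinForm.isSymm_iff.1 (Matrix.isSymm_toBilin'_iff_isSymm.2 hsymm)) v w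
  simpa only [Matrix.toBilin'_apply'] using h

/-! ### Contraction of the dispersion -/

theorem dispersion_average (e : Sym2 (Fin n)) (w : Fin n → ℝ) :
    dispersion (average e w) = dispersion w - (w ⬝ᵥ edgeLaplacian e *ᵥ w) / 2 := by
  have hmean : 𝔼 i, average e w i = 𝔼 i, w i := by
    simp only [Fintype.expect_eq_sum_div_card, sum_average]
  rw [dotProduct_edgeLaplacian_mulVec, dispersion, dispersion, hmean]
  set c := 𝔼 i, w i
  have hcomp := Equiv.sum_comp (edgeSwap e) fun k => (w k - c) ^ 2
  calc ∑ k, (average e w k - c) ^ 2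
      = ∑ k, ((w k - c) ^ 2 / 2 + (w (edgeSwap e k) - c) ^ 2 / 2
          - (w k - w (edgeSwap e k)) ^ 2 / 4) :=
        Finset.sum_congr rfl fun k _ => by rw [average_eq]; ring
    _ = _ := by
        rw [Finset.sum_sub_distrib, Finset.sum_add_distrib, ← Finset.sum_div, ← Finset.sum_div,
          ← Finset.sum_div, hcomp]
        ring

theorem dispersion_average_le (e : Sym2 (Fin n)) (w : Fin n → ℝ) :
    dispersion (average e w) ≤ dispersion w := by
  have h := (edgeLaplacian_posSemidef e).dotProduct_mulVec_nonneg w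
  rw [star_trivial] at h
  rw [dispersion_average]
  linarith

section Contraction

variable {G : SimpleGraph (Fin n)} {p : Sym2 (Fin n) → ℝ}

theorem exists_poincare (hG : G.Connected) (hp : IsEdgeLaw G p) :
    ∃ K : ℝ, 1 ≤ K ∧ ∀ w : Fin n → ℝ, dispersion w ≤ K * (w ⬝ᵥ weightedLaplacian p *ᵥ w) := by
  choose u hu using exists_weightedLaplacian_mulVec_eq hG hp
  have hL := weightedLaplacian_posSemidef hp.nonneg
  have henergy : ∀ w, 0 ≤ w ⬝ᵥ weightedLaplacian p *ᵥ w := fun w => by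
    simpa using hL.dotProduct_mulVec_nonneg w
  have hdev : ∀ (w : Fin n → ℝ) k, w k - 𝔼 i, w i = u k ⬝ᵥ weightedLaplacian p *ᵥ w :=
    fun w k => by
      rw [← weightedLaplacian_mulVec_dotProduct, hu, sub_dotProduct, single_one_dotProduct,
        Fintype.expect_eq_sum_div_card, Fintype.card_fin]
      simp [dotProduct, ← Finset.mul_sum, div_eq_inv_mul]
  refine ⟨1 + ∑ k, u k ⬝ᵥ weightedLaplacian p *ᵥ u k,
    le_add_of_nonneg_right (Finset.sum_nonneg fun k _ => henergy (u k)), fun w => ?_⟩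
  calc dispersion w = ∑ k, (u k ⬝ᵥ weightedLaplacian p *ᵥ w) ^ 2 :=
        Finset.sum_congr rfl fun k _ => by rw [hdev]
    _ ≤ ∑ k, (u k ⬝ᵥ weightedLaplacian p *ᵥ u k) * (w ⬝ᵥ weightedLaplacian p *ᵥ w) :=
        Finset.sum_le_sum fun k _ => sq_dotProduct_mulVec_le hL _ _
    _ ≤ _ := by
        rw [← Finset.sum_mul]
        exact mul_le_mul_of_nonneg_right (le_add_of_nonneg_left zero_le_one) (henergy w)

theorem exists_sum_dispersion_average_le (hG : G.Connected) (hp : IsEdgeLaw G p) :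
    ∃ q : ℝ, 0 < q ∧ q < 1 ∧ ∀ w : Fin n → ℝ,
      ∑ e, p e * dispersion (average e w) ≤ q * dispersion w := by
  obtain ⟨K, hK, hpoincare⟩ := exists_poincare hG hp
  have : 0 < K := one_pos.trans_le hK
  refine ⟨1 - 1 / (2 * K), ?_, sub_lt_self _ (by positivity), fun w => ?_⟩
  · rw [sub_pos, div_lt_one (by positivity)]
    linarith
  have hmean : ∑ e, p e * dispersion (average e w)
      = dispersion w - (w ⬝ᵥ weightedLaplacian p *ᵥ w) / 2 := by
    simp only [dispersion_average, mul_sub, Finset.sum_sub_distrib, ← Finset.sum_mul,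
      hp.sum_eq_one, one_mul, dotProduct_weightedLaplacian_mulVec, Finset.sum_div, mul_div_assoc]
  have hdiv : dispersion w / (2 * K) ≤ (w ⬝ᵥ weightedLaplacian p *ᵥ w) / 2 := by
    rw [div_le_iff₀ (by positivity)]
    linarith [hpoincare w]
  rw [hmean, sub_mul, one_mul, one_div_mul_eq_div]
  exact sub_le_sub_left hdiv _

theorem exists_sum_dispersion_average_add_le (hG : G.Connected) (hp : IsEdgeLaw G p) :
    ∃ q A : ℝ, 0 < q ∧ q < 1 ∧ 0 ≤ A ∧ ∀ (w : Fin n → ℝ) (δ : Sym2 (Fin n) → Fin n → ℝ),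
      ∑ e, p e * dispersion (average e (w + δ e))
        ≤ q * dispersion w + A * ∑ e, p e * ∑ k, δ e k ^ 2 := by
  obtain ⟨q, hq0, hq1, hq⟩ := exists_sum_dispersion_average_le hG hp
  set η := (1 - q) / (2 * q) with hη_def
  have hη : 0 < η := div_pos (by linarith) (by positivity)
  have hηq : (1 + η) * q = (1 + q) / 2 := by
    rw [hη_def]
    field_simp
    ring
  refine ⟨(1 + q) / 2, 1 + 1 / η, by linarith, by linarith, by positivity, fun w δ => ?_⟩
  have hedge : ∀ e, dispersion (average e (w + δ e))
      ≤ (1 + η) * dispersion (average e w) + (1 + 1 / η) * ∑ k, δ e k ^ 2 := fun e => by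
    rw [average_add]
    have hδ := (dispersion_average_le e (δ e)).trans (dispersion_le_sum_sq _)
    exact (dispersion_add_le hη _ _).trans (by gcongr)
  calc ∑ e, p e * dispersion (average e (w + δ e))
      ≤ ∑ e, p e * ((1 + η) * dispersion (average e w) + (1 + 1 / η) * ∑ k, δ e k ^ 2) :=
        Finset.sum_le_sum fun e _ => mul_le_mul_of_nonneg_left (hedge e) (hp.nonneg e)
    _ = (1 + η) * ∑ e, p e * dispersion (average e w)
          + (1 + 1 / η) * ∑ e, p e * ∑ k, δ e k ^ 2 := by
        simp only [mul_add, Finset.sum_add_distrib, Finset.mul_sum, mul_left_comm]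
    _ ≤ (1 + q) / 2 * dispersion w + (1 + 1 / η) * ∑ e, p e * ∑ k, δ e k ^ 2 := by
        rw [← hηq, mul_assoc]
        gcongr
        exact hq w

end Contraction

/-! ### Positivity of the spectral constants -/

theorem exists_eigenvector_notMem_span {ι : Type*} [Fintype ι] [DecidableEq ι] {A : Matrix ι ι ℝ}
    (hA : A.IsHermitian) {i j : Fin (Fintype.card ι)} (hij : i ≠ j) (w : ι → ℝ) :
    ∃ l v, (l = i ∨ l = j) ∧ A *ᵥ v = hA.eigenvalues₀ l • v ∧ v ∉ Submodule.span ℝ {w} := by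
  let φ := Fintype.equivOfCardEq (Fintype.card_fin (Fintype.card ι))
  have heigen : ∀ l, A *ᵥ hA.eigenvectorBasis (φ l)
      = hA.eigenvalues₀ l • ⇑(hA.eigenvectorBasis (φ l)) := fun l => by
    rw [hA.mulVec_eigenvectorBasis]
    simp [Matrix.IsHermitian.eigenvalues, φ]
  by_contra! h
  obtain ⟨a, ha⟩ := Submodule.mem_span_singleton.1 (h i _ (.inl rfl) (heigen i))
  obtain ⟨b, hb⟩ := Submodule.mem_span_singleton.1 (h j _ (.inr rfl) (heigen j))
  have ha' : a • WithLp.toLp 2 w = hA.eigenvectorBasis (φ i) := by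
    ext k
    exact congrFun ha k
  have hb' : b • WithLp.toLp 2 w = hA.eigenvectorBasis (φ j) := by
    ext k
    exact congrFun hb k
  have horth := hA.eigenvectorBasis.orthonormal.2 (φ.injective.ne hij)
  have hi := hA.eigenvectorBasis.orthonormal.ne_zero (φ i)
  have hj := hA.eigenvectorBasis.orthonormal.ne_zero (φ j)
  simp only [← ha', ← hb', smul_ne_zero_iff] at horth hi hj
  rw [real_inner_smul_left, real_inner_smul_right] at horth
  exact mul_ne_zero hi.1 (mul_ne_zero hj.1 (inner_self_ne_zero.2 hi.2)) horth

section Spectral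

variable {G : SimpleGraph (Fin n)} {p : Sym2 (Fin n) → ℝ}

theorem mem_span_one_of_weightedLaplacian_mulVec_eq_smul (hG : G.Connected) (hp : IsEdgeLaw G p)
    {c : ℝ} (hc : c ≤ 0) {v : Fin n → ℝ} (hv : weightedLaplacian p *ᵥ v = c • v) :
    v ∈ Submodule.span ℝ {(1 : Fin n → ℝ)} := by
  have hnonpos : v ⬝ᵥ weightedLaplacian p *ᵥ v ≤ 0 := by
    rw [hv, dotProduct_smul]
    exact mul_nonpos_of_nonpos_of_nonneg hc (Finset.sum_nonneg fun _ _ => mul_self_nonneg _)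
  obtain ⟨i⟩ := hG.nonempty
  refine Submodule.mem_span_singleton.2 ⟨v i, funext fun j => ?_⟩
  simpa using eq_of_dotProduct_weightedLaplacian_nonpos hG hp hnonpos i j

theorem spectralGap_pos (hn : 2 ≤ n) (hG : G.Connected) (hp : IsEdgeLaw G p) :
    0 < spectralGap hn p := by
  by_contra! hgap
  let i : Fin (Fintype.card (Fin n)) := ⟨n - 2, by rw [Fintype.card_fin]; omega⟩
  let j : Fin (Fintype.card (Fin n)) := ⟨n - 1, by rw [Fintype.card_fin]; omega⟩
  have hij : i < j := Fin.mk_lt_mk.2 (by omega)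
  obtain ⟨l, v, hl, hv, hspan⟩ :=
    exists_eigenvector_notMem_span (weightedLaplacian_isHermitian p) hij.ne 1
  have hil : i ≤ l := by rcases hl with rfl | rfl <;> [rfl; exact hij.le]
  exact hspan (mem_span_one_of_weightedLaplacian_mulVec_eq_smul hG hp
    (((weightedLaplacian_isHermitian p).eigenvalues₀_antitone hil).trans hgap) hv)

theorem lambdaTwo_lt_one (hn : 2 ≤ n) (hG : G.Connected) (hp : IsEdgeLaw G p) :
    lambdaTwo hn p < 1 := by
  by_contra! hlambda
  let i : Fin (Fintype.card (Fin n)) := ⟨1, by rw [Fintype.card_fin]; omega⟩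
  let j : Fin (Fintype.card (Fin n)) := ⟨0, by rw [Fintype.card_fin]; omega⟩
  have hji : j < i := Fin.mk_lt_mk.2 one_pos
  obtain ⟨l, v, hl, hv, hspan⟩ :=
    exists_eigenvector_notMem_span (meanAveraging_isHermitian p) hji.ne' 1
  have hli : l ≤ i := by rcases hl with rfl | rfl <;> [rfl; exact hji.le]
  have hone := hlambda.trans ((meanAveraging_isHermitian p).eigenvalues₀_antitone hli)
  generalize (meanAveraging_isHermitian p).eigenvalues₀ l = c at hv hone
  have hL : weightedLaplacian p *ᵥ v = (2 * (1 - c)) • v := by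
    rw [meanAveraging, Matrix.sub_mulVec, Matrix.one_mulVec, Matrix.smul_mulVec,
      sub_eq_iff_eq_add] at hv
    rw [mul_smul, sub_smul, one_smul, sub_eq_iff_eq_add'.2 hv, smul_smul]
    norm_num
  exact hspan (mem_span_one_of_weightedLaplacian_mulVec_eq_smul hG hp (by linarith) hL)

theorem cTilde_pos (hn : 2 ≤ n) (hG : G.Connected) (hp : IsEdgeLaw G p) : 0 < cTilde hn p := by
  rw [cTilde, sub_pos, Real.sqrt_lt' one_pos, one_pow]
  exact lambdaTwo_lt_one hn hG hp

end Spectral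

/-! ### Expectations over histories of independent draws -/

section PathMean

variable {E : Type*} [Fintype E] {p : E → ℝ}

/-- The Markov operator of a growing history of independent draws of law `p`: the conditional mean
of `F` after one more draw. Histories list the most recent draw first. -/
def transition (p : E → ℝ) : Module.End ℝ (List E → ℝ) where
  toFun F l := ∑ x, p x * F (x :: l)
  map_add' F H := by
    ext l
    simp only [Pi.add_apply, mul_add, Finset.sum_add_distrib]
  map_smul' c F := by
    ext l
    simp only [Pi.smul_apply, smul_eq_mul, mul_left_comm, Finset.mul_sum, RingHom.id_apply]

/-- The mean of a function of the history of `t` independent draws of law `p`. -/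
def pathMean (p : E → ℝ) (t : ℕ) : (List E → ℝ) →ₗ[ℝ] ℝ := LinearMap.proj [] ∘ₗ transition p ^ t

theorem transition_apply (p : E → ℝ) (F : List E → ℝ) (l : List E) :
    transition p F l = ∑ x, p x * F (x :: l) := rfl

theorem pathMean_zero (p : E → ℝ) (F : List E → ℝ) : pathMean p 0 F = F [] := rfl

theorem pathMean_succ (p : E → ℝ) (t : ℕ) (F : List E → ℝ) :
    pathMean p (t + 1) F = pathMean p t (transition p F) := rfl

theorem pathMean_mono (hp : ∀ x, 0 ≤ p x) (t : ℕ) {F H : List E → ℝ} (h : F ≤ H) :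
    pathMean p t F ≤ pathMean p t H := by
  induction t generalizing F H with
  | zero => exact h []
  | succ _ ih =>
    exact ih fun l => Finset.sum_le_sum fun x _ => mul_le_mul_of_nonneg_left (h _) (hp x)

theorem pathMean_const (hp : ∑ x, p x = 1) (t : ℕ) (c : ℝ) :
    pathMean p t (Function.const _ c) = c := by
  induction t with
  | zero => rfl
  | succ t ih =>
    have h : transition p (Function.const _ c) = Function.const _ c := by
      ext l
      simp only [transition_apply, Function.const_apply, ← Finset.sum_mul, hp, one_mul]
    rw [pathMean_succ, h, ih]

theorem pathMean_le_pow_mul (hp : ∀ x, 0 ≤ p x) {ρ : ℝ} (hρ : 0 ≤ ρ) {F : List E → ℝ}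
    (hF : transition p F ≤ ρ • F) (t : ℕ) : pathMean p t F ≤ ρ ^ t * F [] := by
  induction t with
  | zero => rw [pathMean_zero, pow_zero, one_mul]
  | succ t ih =>
    calc pathMean p (t + 1) F ≤ pathMean p t (ρ • F) := pathMean_mono hp t hF
      _ = ρ * pathMean p t F := map_smul _ _ _
      _ ≤ ρ * (ρ ^ t * F []) := mul_le_mul_of_nonneg_left ih hρ
      _ = ρ ^ (t + 1) * F [] := by rw [pow_succ', mul_assoc]

theorem sq_pathMean_le (hp : p ∈ stdSimplex ℝ E) (t : ℕ) (F : List E → ℝ) :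
    pathMean p t F ^ 2 ≤ pathMean p t (F ^ 2) := by
  set c := pathMean p t F with hc
  have hvar : F ^ 2 - (2 * c) • F + Function.const _ (c ^ 2) = fun l => (F l - c) ^ 2 := by
    ext l
    simp only [Pi.add_apply, Pi.sub_apply, Pi.pow_apply, Pi.smul_apply, smul_eq_mul,
      Function.const_apply]
    ring
  have hnonneg : 0 ≤ pathMean p t (F ^ 2 - (2 * c) • F + Function.const _ (c ^ 2)) := by
    rw [hvar, ← map_zero (pathMean p t)]
    exact pathMean_mono hp.1 t fun l => sq_nonneg _
  rw [map_add, map_sub, map_smul, pathMean_const hp.2, ← hc, smul_eq_mul] at hnonneg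
  linarith

end PathMean

/-- The history of the first `t` terms of a sequence, the most recent one first. -/
def history {E : Type*} (e : ℕ → E) (t : ℕ) : List E := (List.ofFn fun i : Fin t => e i).reverse

theorem history_succ {E : Type*} (e : ℕ → E) (t : ℕ) :
    history e (t + 1) = e t :: history e t := by
  simp only [history, List.ofFn_succ_last, List.reverse_append, List.reverse_singleton,
    List.singleton_append, Fin.val_castSucc, Fin.val_last]

section IntegralHistory

variable {Ω : Type*} [MeasurableSpace Ω] {μ : Measure Ω}

theorem integral_comp_prodMk_eq_integral_sum [IsFiniteMeasure μ] {E β : Type*} [Fintype E]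
    [MeasurableSpace E] [MeasurableSingletonClass E] [Finite β] [MeasurableSpace β]
    [MeasurableSingletonClass β] {X : Ω → E} {Y : Ω → β} (hX : Measurable X) (hY : Measurable Y)
    (hXY : IndepFun X Y μ) (g : E → β → ℝ) :
    ∫ ω, g (X ω) (Y ω) ∂μ = ∫ ω, ∑ x, μ.real (X ⁻¹' {x}) * g x (Y ω) ∂μ := by
  have hlaw := (indepFun_iff_map_prod_eq_prod_map_map hX.aemeasurable hY.aemeasurable).1 hXY
  calc ∫ ω, g (X ω) (Y ω) ∂μ
      = ∫ z, g z.1 z.2 ∂μ.map fun ω => (X ω, Y ω) :=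
        (integral_map (hX.prodMk hY).aemeasurable
          (Measurable.of_discrete.aestronglyMeasurable (f := fun z : E × β => g z.1 z.2))).symm
    _ = ∫ y, ∫ x, g x y ∂μ.map X ∂μ.map Y := by
        rw [hlaw]
        exact integral_prod_symm (fun z : E × β => g z.1 z.2) .of_finite
    _ = ∫ y, ∑ x, μ.real (X ⁻¹' {x}) * g x y ∂μ.map Y := by
        congr 1 with y
        rw [integral_fintype .of_finite]
        simp only [map_measureReal_apply hX (measurableSet_singleton _), smul_eq_mul]
    _ = ∫ ω, ∑ x, μ.real (X ⁻¹' {x}) * g x (Y ω) ∂μ :=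
        integral_map hY.aemeasurable Measurable.of_discrete.aestronglyMeasurable

theorem IsEdgeSampling.integral_history {p : Sym2 (Fin n) → ℝ} (hp : ∀ e, 0 ≤ p e)
    {e : ℕ → Ω → Sym2 (Fin n)} (he : IsEdgeSampling μ p e) (t : ℕ)
    (F : List (Sym2 (Fin n)) → ℝ) :
    ∫ ω, F (history (fun s => e s ω) t) ∂μ = pathMean p t F := by
  let _ : MeasurableSpace (Sym2 (Fin n)) := ⊤
  have hprob := he.indep.isProbabilityMeasure
  have he_meas : ∀ s, Measurable (e s) := he.measurable
  induction t generalizing F with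
  | zero => simp [history, pathMean_zero]
  | succ t ih =>
    have hpast : Measurable fun ω (i : Finset.range t) => e i ω :=
      measurable_pi_lambda _ fun i => he_meas i
    have heval : Measurable fun y : ({t} : Finset ℕ) → Sym2 (Fin n) =>
        y ⟨t, Finset.mem_singleton_self t⟩ := measurable_pi_apply _
    have hindep : IndepFun (e t) (fun ω (i : Finset.range t) => e i ω) μ :=
      (he.indep.indepFun_finset {t} (Finset.range t) (by simp) he_meas).comp heval measurable_id
    have hlaw : ∀ x, μ.real (e t ⁻¹' {x}) = p x := fun x => by
      rw [measureReal_def, he.law, ENNReal.toReal_ofReal (hp x)]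
    have hcons := integral_comp_prodMk_eq_integral_sum (he_meas t) hpast hindep fun x y =>
        F (x :: (List.ofFn fun i : Fin t => y ⟨i, Finset.mem_range.2 i.2⟩).reverse)
    simp only [hlaw] at hcons
    simp only [history_succ]
    exact hcons.trans (ih (transition p F))

end IntegralHistory

/-! ### Dynamic average consensus -/

/-- `acc` tracks the mean of the time-varying values `V` along histories of edges: at each draw
every node adds the increment of its value, and then the endpoints of the edge average. -/
structure IsTracking (V acc : List (Sym2 (Fin n)) → Fin n → ℝ) : Prop where
  nil : acc [] = V []
  cons x l : acc (x :: l) = average x (acc l + (V (x :: l) - V l))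

section Tracking

variable {V acc : List (Sym2 (Fin n)) → Fin n → ℝ}

theorem IsTracking.expect_eq (h : IsTracking V acc) (l : List (Sym2 (Fin n))) :
    𝔼 k, acc l k = 𝔼 k, V l k := by
  simp only [Fintype.expect_eq_sum_div_card]
  congr 1
  induction l with
  | nil => rw [h.nil]
  | cons x l ih =>
    simp only [h.cons, sum_average, Pi.add_apply, Pi.sub_apply, Finset.sum_add_distrib,
      Finset.sum_sub_distrib, ih, add_sub_cancel]

theorem IsTracking.sum_sub_sq_le (h : IsTracking V acc) (v : Fin n → ℝ)
    (l : List (Sym2 (Fin n))) :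
    ∑ k, (acc l k - 𝔼 i, v i) ^ 2 ≤ dispersion (acc l) + ∑ k, (V l k - v k) ^ 2 := by
  rw [sum_sub_sq_eq, h.expect_eq, ← Finset.expect_sub_distrib]
  gcongr
  exact card_mul_sq_expect_le _

theorem IsTracking.transition_dispersion_le (h : IsTracking V acc) {p : Sym2 (Fin n) → ℝ}
    (hp : p ∈ stdSimplex ℝ (Sym2 (Fin n))) {q A : ℝ} (hA : 0 ≤ A)
    (hq : ∀ (w : Fin n → ℝ) (δ : Sym2 (Fin n) → Fin n → ℝ),
      ∑ e, p e * dispersion (average e (w + δ e))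
        ≤ q * dispersion w + A * ∑ e, p e * ∑ k, δ e k ^ 2)
    (v : Fin n → ℝ) :
    transition p (fun l => dispersion (acc l)) ≤ q • (fun l => dispersion (acc l)) +
      (2 * A) • (transition p (fun l => ∑ k, (V l k - v k) ^ 2) +
        fun l => ∑ k, (V l k - v k) ^ 2) := by
  intro l
  have hincrement : ∀ x, ∑ k, (V (x :: l) k - V l k) ^ 2
      ≤ 2 * (∑ k, (V (x :: l) k - v k) ^ 2 + ∑ k, (V l k - v k) ^ 2) := fun x => by
    rw [← Finset.sum_add_distrib, Finset.mul_sum]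
    refine Finset.sum_le_sum fun k _ => ?_
    linarith [sq_nonneg (V (x :: l) k - v k + (V l k - v k))]
  have hsum : ∑ x, p x * ∑ k, (V (x :: l) k - V l k) ^ 2
      ≤ 2 * (∑ x, p x * ∑ k, (V (x :: l) k - v k) ^ 2 + ∑ k, (V l k - v k) ^ 2) := by
    refine (Finset.sum_le_sum fun x _ =>
      mul_le_mul_of_nonneg_left (hincrement x) (hp.1 x)).trans_eq ?_
    simp only [mul_left_comm (p _) 2, ← Finset.mul_sum, mul_add, Finset.sum_add_distrib,
      ← Finset.sum_mul, hp.2, one_mul]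
  calc ∑ x, p x * dispersion (acc (x :: l))
      ≤ q * dispersion (acc l) + A * ∑ x, p x * ∑ k, (V (x :: l) k - V l k) ^ 2 := by
        simp only [h.cons]
        exact hq (acc l) fun x => V (x :: l) - V l
    _ ≤ q * dispersion (acc l) +
        A * (2 * (∑ x, p x * ∑ k, (V (x :: l) k - v k) ^ 2 + ∑ k, (V l k - v k) ^ 2)) := by
        gcongr
    _ = _ := by
        simp only [Pi.add_apply, Pi.smul_apply, smul_eq_mul, transition_apply]
        ring

theorem le_mul_pow_of_le_mul_add {D : ℕ → ℝ} {q r c : ℝ} (hq : 0 ≤ q) (hqr : q < r)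
    (h0 : D 0 ≤ c / (r - q)) (h : ∀ t, D (t + 1) ≤ q * D t + c * r ^ t) (t : ℕ) :
    D t ≤ c / (r - q) * r ^ t := by
  have hrq : r - q ≠ 0 := (sub_pos.2 hqr).ne'
  induction t with
  | zero => rwa [pow_zero, mul_one]
  | succ t ih =>
    calc D (t + 1) ≤ q * (c / (r - q) * r ^ t) + c * r ^ t :=
          (h t).trans (by gcongr)
      _ = c / (r - q) * r ^ (t + 1) := by
          field_simp
          ring

theorem exists_pathMean_sum_sub_sq_le {G : SimpleGraph (Fin n)} {p : Sym2 (Fin n) → ℝ}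
    (hG : G.Connected) (hp : IsEdgeLaw G p) {ρ : ℝ} (hρ0 : 0 ≤ ρ) (hρ1 : ρ < 1) :
    ∃ K r : ℝ, 0 < K ∧ 0 < r ∧ r < 1 ∧
      ∀ (V acc : List (Sym2 (Fin n)) → Fin n → ℝ) (v : Fin n → ℝ) (B : ℝ),
        IsTracking V acc → V [] = 0 → 0 ≤ B →
        (∀ t, pathMean p t (fun l => ∑ k, (V l k - v k) ^ 2) ≤ B * ρ ^ t) →
        ∀ t, pathMean p t (fun l => ∑ k, (acc l k - 𝔼 i, v i) ^ 2) ≤ K * B * r ^ t := by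
  obtain ⟨q, A, hq0, hq1, hA, hq⟩ := exists_sum_dispersion_average_add_le hG hp
  obtain ⟨r, hqρr, hr1⟩ := exists_between (max_lt hq1 hρ1)
  obtain ⟨hqr, hρr⟩ := max_lt_iff.1 hqρr
  have hr0 : 0 < r := hq0.trans hqr
  have : 0 < r - q := sub_pos.2 hqr
  refine ⟨4 * A / (r - q) + 1, r, by positivity, hr0, hr1, fun V acc v B h hV hB hVv t => ?_⟩
  have hVv' : ∀ s t, s ≤ t → pathMean p t (fun l => ∑ k, (V l k - v k) ^ 2) ≤ B * r ^ s :=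
    fun s t hst => (hVv t).trans (mul_le_mul_of_nonneg_left
      ((pow_le_pow_left₀ hρ0 hρr.le t).trans (pow_le_pow_of_le_one hr0.le hr1.le hst)) hB)
  have hdisp : pathMean p t (fun l => dispersion (acc l)) ≤ 4 * A * B / (r - q) * r ^ t := by
    refine le_mul_pow_of_le_mul_add (D := fun t => pathMean p t fun l => dispersion (acc l))
      hq0.le hqr ?_ (fun t => ?_) t
    · simp only [pathMean_zero, h.nil, hV, dispersion, Pi.zero_apply, Finset.expect_const_zero]
      simpa using by positivity
    · have hstep := pathMean_mono hp.nonneg t (h.transition_dispersion_le hp.mem_stdSimplex hA hq v)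
      rw [← pathMean_succ, map_add, map_smul, map_smul, map_add, ← pathMean_succ, smul_eq_mul,
        smul_eq_mul] at hstep
      have hsum := add_le_add (hVv' t (t + 1) t.le_succ) (hVv' t t le_rfl)
      linarith [mul_le_mul_of_nonneg_left hsum (mul_nonneg zero_le_two hA)]
  calc pathMean p t (fun l => ∑ k, (acc l k - 𝔼 i, v i) ^ 2)
      ≤ pathMean p t ((fun l => dispersion (acc l)) + fun l => ∑ k, (V l k - v k) ^ 2) :=
        pathMean_mono hp.nonneg t (h.sum_sub_sq_le v)
    _ ≤ 4 * A * B / (r - q) * r ^ t + B * r ^ t := by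
        rw [map_add]
        exact add_le_add hdisp (hVv' t t le_rfl)
    _ = (4 * A / (r - q) + 1) * B * r ^ t := by ring

end Tracking

/-! ### The algorithm along a history of edges -/

/-- The state of Adaptive GoTrim after the edges of a history, the most recent one first. -/
def stateAfter (mode : Schedule) (α : ℝ) (X : Fin n → ℝ) (l : List (Sym2 (Fin n))) : State n :=
  l.foldr (fun x s => step mode α X s x) (State.init X)

theorem run_eq_stateAfter_history (mode : Schedule) (α : ℝ) (X : Fin n → ℝ)
    (e : ℕ → Sym2 (Fin n)) (t : ℕ) : run mode α X e t = stateAfter mode α X (history e t) := by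
  induction t with
  | zero => rfl
  | succ t ih => rw [history_succ, run, ih, stateAfter, stateAfter, List.foldr_cons]

open Classical in
/-- The indicator that node `k` is refreshed when edge `x` is drawn. -/
def activity (mode : Schedule) (k : Fin n) (x : Sym2 (Fin n)) : ℝ :=
  if mode.Active x k then 1 else 0

theorem activity_nonneg (mode : Schedule) (k : Fin n) (x : Sym2 (Fin n)) :
    0 ≤ activity mode k x := by
  unfold activity
  split_ifs <;> norm_num

theorem activity_le_one (mode : Schedule) (k : Fin n) (x : Sym2 (Fin n)) :
    activity mode k x ≤ 1 := by
  unfold activity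
  split_ifs <;> norm_num

/-- The probability that node `k` is refreshed at an iteration. -/
def refreshProb (mode : Schedule) (p : Sym2 (Fin n) → ℝ) (k : Fin n) : ℝ :=
  ∑ x, p x * activity mode k x

theorem refreshProb_nonneg {p : Sym2 (Fin n) → ℝ} (hp : p ∈ stdSimplex ℝ (Sym2 (Fin n)))
    (mode : Schedule) (k : Fin n) : 0 ≤ refreshProb mode p k :=
  Finset.sum_nonneg fun x _ => mul_nonneg (hp.1 x) (activity_nonneg mode k x)

theorem refreshProb_le_one {p : Sym2 (Fin n) → ℝ} (hp : p ∈ stdSimplex ℝ (Sym2 (Fin n)))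
    (mode : Schedule) (k : Fin n) : refreshProb mode p k ≤ 1 := by
  rw [← hp.2]
  exact Finset.sum_le_sum fun x _ => mul_le_of_le_one_right (hp.1 x) (activity_le_one mode k x)

theorem refreshProb_pos {G : SimpleGraph (Fin n)} {p : Sym2 (Fin n) → ℝ} (hn : 2 ≤ n)
    (hG : G.Connected) (hp : IsEdgeLaw G p) (mode : Schedule) (k : Fin n) :
    0 < refreshProb mode p k := by
  have := Fin.nontrivial_iff_two_le.2 hn
  obtain ⟨j, hj⟩ := hG.preconnected.exists_adj_of_nontrivial k
  refine Finset.sum_pos' (fun x _ => mul_nonneg (hp.nonneg x) (activity_nonneg mode k x))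
    ⟨s(k, j), Finset.mem_univ _, mul_pos (hp.pos _ hj) ?_⟩
  cases mode <;> simp [activity, Schedule.Active]

/-- The normalized rank `(r_k - 1) / n`, which `R'_k` estimates. -/
def normalizedRank (X : Fin n → ℝ) (k : Fin n) : ℝ := ((rank X k : ℝ) - 1) / n

/-- The indicator that node `j` holds an auxiliary observation below `y`. -/
def State.below (s : State n) (y : ℝ) (j : Fin n) : ℝ := if s.aux j < y then 1 else 0

theorem State.below_nonneg (s : State n) (y : ℝ) (j : Fin n) : 0 ≤ s.below y j := by
  unfold below
  split_ifs <;> norm_num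

theorem State.below_le_one (s : State n) (y : ℝ) (j : Fin n) : s.below y j ≤ 1 := by
  unfold below
  split_ifs <;> norm_num

section StateAfter

variable (mode : Schedule) (α : ℝ) (X : Fin n → ℝ)

theorem stateAfter_cons (x : Sym2 (Fin n)) (l : List (Sym2 (Fin n))) :
    stateAfter mode α X (x :: l) = step mode α X (stateAfter mode α X l) x := rfl

theorem below_stateAfter_cons (y : ℝ) (x : Sym2 (Fin n)) (l : List (Sym2 (Fin n))) :
    (stateAfter mode α X (x :: l)).below y = (stateAfter mode α X l).below y ∘ edgeSwap x := rfl

theorem expect_below_stateAfter (k : Fin n) (l : List (Sym2 (Fin n))) :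
    𝔼 j, (stateAfter mode α X l).below (X k) j = normalizedRank X k := by
  rw [Fintype.expect_eq_sum_div_card, Fintype.card_fin, normalizedRank]
  congr 1
  induction l with
  | nil =>
    change ∑ j, (if X j < X k then (1 : ℝ) else 0) = _
    rw [Finset.sum_boole, rank, Nat.cast_add, Nat.cast_one, add_sub_cancel_left]
  | cons x l ih => rw [below_stateAfter_cons, ← ih]; exact Equiv.sum_comp _ _

theorem one_le_count (k : Fin n) (l : List (Sym2 (Fin n))) :
    1 ≤ (stateAfter mode α X l).count k := by
  induction l with
  | nil => exact le_rfl
  | cons x l ih =>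
    simp only [stateAfter_cons, step]
    split_ifs <;> omega

theorem count_cons (k : Fin n) (x : Sym2 (Fin n)) (l : List (Sym2 (Fin n))) :
    ((stateAfter mode α X (x :: l)).count k : ℝ)
      = (stateAfter mode α X l).count k + activity mode k x := by
  simp only [stateAfter_cons, step, activity]
  split_ifs
  · exact Nat.cast_succ _
  · exact (add_zero _).symm

theorem count_sub_one_mul_normRank_cons (k : Fin n) (x : Sym2 (Fin n))
    (l : List (Sym2 (Fin n))) :
    (((stateAfter mode α X (x :: l)).count k : ℝ) - 1) * (stateAfter mode α X (x :: l)).normRank k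
      = ((stateAfter mode α X l).count k - 1) * (stateAfter mode α X l).normRank k
        + activity mode k x * (stateAfter mode α X l).below (X k) k := by
  have hcount : ((stateAfter mode α X l).count k : ℝ) ≠ 0 :=
    Nat.cast_ne_zero.2 (Nat.one_le_iff_ne_zero.1 (one_le_count mode α X k l))
  rw [count_cons]
  simp only [stateAfter_cons, step, activity, State.below]
  by_cases ha : mode.Active x k
  · simp only [ha, if_true]
    field_simp
    ring
  · simp only [ha, if_false]
    ring

theorem wt_eq_weight (k : Fin n) (l : List (Sym2 (Fin n))) :
    (stateAfter mode α X l).count k = 1 ∨ (stateAfter mode α X l).wt k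
      = weight n α (n * (stateAfter mode α X l).normRank k + 1) := by
  induction l with
  | nil => exact Or.inl rfl
  | cons x l ih =>
    simp only [stateAfter_cons, step]
    by_cases ha : mode.Active x k
    · simp only [ha, if_true, or_true]
    · simpa only [ha, if_false] using ih

theorem isTracking_mass :
    IsTracking (fun l => (stateAfter mode α X l).wt) fun l => (stateAfter mode α X l).mass :=
  ⟨rfl, fun _ _ => rfl⟩

theorem isTracking_num :
    IsTracking (fun l => (stateAfter mode α X l).wt * X) fun l => (stateAfter mode α X l).num where
  nil := (zero_mul X).symm
  cons x l := by
    simp only [← sub_mul]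
    rfl

theorem normRank_eq_zero {k : Fin n} (hk : rank X k = 1) (l : List (Sym2 (Fin n))) :
    (stateAfter mode α X l).normRank k = 0 := by
  have hbelow : ∀ l, ¬ (stateAfter mode α X l).aux k < X k := fun l => by
    have hmean := expect_below_stateAfter mode α X k l
    rw [normalizedRank, hk, Nat.cast_one, sub_self, zero_div,
      Finset.expect_eq_zero_iff_of_nonneg fun j _ => State.below_nonneg _ _ j] at hmean
    simpa [State.below] using hmean k (Finset.mem_univ k)
  induction l with
  | nil => rfl
  | cons x l ih =>
    simp only [stateAfter_cons, step, ih, if_neg (hbelow l), mul_zero, add_zero, ite_self]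

end StateAfter

/-! ### Weights, ranks and the trimmed mean -/

theorem two_mul_trimCount_lt {α : ℝ} (hn : 0 < n) (hα : α < 1 / 2) : 2 * trimCount n α < n := by
  have hn' : (0 : ℝ) < n := Nat.cast_pos.2 hn
  rcases le_or_gt 0 α with hα0 | hα0
  · have hfloor : (trimCount n α : ℝ) ≤ α * n := Nat.floor_le (by positivity)
    have hlt : ((2 * trimCount n α : ℕ) : ℝ) < n := by
      push_cast
      nlinarith
    exact_mod_cast hlt
  · rwa [trimCount, Nat.floor_of_nonpos (mul_nonpos_of_nonpos_of_nonneg hα0.le hn'.le)]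

section Weight

variable {α x : ℝ} {r : ℕ}

theorem weight_of_abs_sub_lt (h : |x - r| < 1 / 2) : weight n α x
    = if trimCount n α + 1 ≤ r ∧ r + trimCount n α ≤ n
      then (1 : ℝ) / (1 - 2 * trimCount n α / n) else 0 := by
  obtain ⟨hlower, hupper⟩ := abs_lt.1 h
  have hmem : x ∈ Set.Icc (leftEnd n α) (rightEnd n α) ↔
      trimCount n α + 1 ≤ r ∧ r + trimCount n α ≤ n := by
    simp only [Set.mem_Icc, leftEnd, rightEnd]
    constructor
    · rintro ⟨ha, hb⟩
      have ha' : (trimCount n α : ℝ) < r := by linarith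
      have hb' : ((r + trimCount n α : ℕ) : ℝ) < (n + 1 : ℕ) := by
        push_cast
        linarith
      exact ⟨by exact_mod_cast ha', Nat.lt_succ_iff.1 (Nat.cast_lt.1 hb')⟩
    · rintro ⟨ha, hb⟩
      have ha' : (trimCount n α + 1 : ℝ) ≤ r := by exact_mod_cast ha
      have hb' : (r + trimCount n α : ℝ) ≤ n := by exact_mod_cast hb
      constructor <;> linarith
  simp only [weight, hmem]

theorem weight_natCast : weight n α r
    = if trimCount n α + 1 ≤ r ∧ r + trimCount n α ≤ n
      then (1 : ℝ) / (1 - 2 * trimCount n α / n) else 0 :=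
  weight_of_abs_sub_lt (by rw [sub_self, abs_zero]; norm_num)

theorem weight_eq_of_abs_sub_lt (h : |x - r| < 1 / 2) : weight n α x = weight n α r := by
  rw [weight_of_abs_sub_lt h, weight_natCast]

theorem trimmed_fraction_pos (hm : 2 * trimCount n α < n) :
    0 < 1 - 2 * trimCount n α / (n : ℝ) := by
  rw [sub_pos, div_lt_one (Nat.cast_pos.2 (pos_of_gt hm))]
  exact_mod_cast hm

theorem weight_nonneg (hm : 2 * trimCount n α < n) (x : ℝ) : 0 ≤ weight n α x := by
  have hpos := trimmed_fraction_pos hm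
  unfold weight
  split_ifs <;> positivity

theorem weight_le (hm : 2 * trimCount n α < n) (x : ℝ) : weight n α x ≤ n := by
  have hn : (0 : ℝ) < n := Nat.cast_pos.2 (pos_of_gt hm)
  have hm' : (2 * trimCount n α + 1 : ℝ) ≤ n := by exact_mod_cast hm
  unfold weight
  split_ifs
  · rw [div_le_iff₀ (trimmed_fraction_pos hm), mul_sub, mul_div_cancel₀ _ hn.ne']
    linarith
  · exact hn.le

theorem wt_nonneg (mode : Schedule) (X : Fin n → ℝ) (hm : 2 * trimCount n α < n) (k : Fin n)
    (l : List (Sym2 (Fin n))) : 0 ≤ (stateAfter mode α X l).wt k := by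
  induction l with
  | nil => exact le_rfl
  | cons x l ih =>
    simp only [stateAfter_cons, step]
    split_ifs <;> first | exact weight_nonneg hm _ | exact ih

theorem wt_le (mode : Schedule) (X : Fin n → ℝ) (hm : 2 * trimCount n α < n) (k : Fin n)
    (l : List (Sym2 (Fin n))) : (stateAfter mode α X l).wt k ≤ n := by
  induction l with
  | nil => exact n.cast_nonneg
  | cons x l ih =>
    simp only [stateAfter_cons, step]
    split_ifs <;> first | exact weight_le hm _ | exact ih

end Weight

section Rank

variable {X : Fin n → ℝ}

theorem one_le_rank (X : Fin n → ℝ) (k : Fin n) : 1 ≤ rank X k := Nat.le_add_right 1 _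

theorem rank_le (X : Fin n → ℝ) (k : Fin n) : rank X k ≤ n := by
  have hcard : (Finset.univ.filter fun l => X l < X k).card < (Finset.univ : Finset (Fin n)).card :=
    Finset.card_lt_card (Finset.filter_ssubset.2 ⟨k, Finset.mem_univ k, lt_irrefl _⟩)
  rw [Finset.card_univ, Fintype.card_fin] at hcard
  rw [rank]
  omega

theorem normalizedRank_nonneg (X : Fin n → ℝ) (k : Fin n) : 0 ≤ normalizedRank X k :=
  div_nonneg (sub_nonneg.2 (Nat.one_le_cast.2 (one_le_rank X k))) n.cast_nonneg

theorem normalizedRank_le_one (X : Fin n → ℝ) (k : Fin n) : normalizedRank X k ≤ 1 := by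
  have hrank : (rank X k : ℝ) ≤ n := Nat.cast_le.2 (rank_le X k)
  exact div_le_one_of_le₀ (by linarith) n.cast_nonneg

theorem rank_lt_rank_iff {i j : Fin n} : rank X i < rank X j ↔ X i < X j := by
  refine ⟨fun h => ?_, fun h => Nat.add_lt_add_left (Finset.card_lt_card ?_) 1⟩
  · by_contra! hle
    exact h.not_ge (Nat.add_le_add_left (Finset.card_le_card
      (Finset.monotone_filter_right _ fun _ _ hl => lt_of_lt_of_le hl hle)) 1)
  · refine (Finset.ssubset_iff_of_subset
      (Finset.monotone_filter_right _ fun _ _ hl => lt_trans hl h)).2 ⟨i, ?_, ?_⟩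
    · exact Finset.mem_filter.2 ⟨Finset.mem_univ i, h⟩
    · exact fun hi => lt_irrefl _ (Finset.mem_filter.1 hi).2

theorem rank_injective (hX : Function.Injective X) : Function.Injective (rank X) :=
  fun _ _ h => hX <| le_antisymm (not_lt.1 fun hlt => (rank_lt_rank_iff.2 hlt).ne' h)
    (not_lt.1 fun hlt => (rank_lt_rank_iff.2 hlt).ne h)

theorem image_rank (hX : Function.Injective X) :
    Finset.univ.image (rank X) = Finset.Icc 1 n := by
  refine Finset.eq_of_subset_of_card_le (Finset.image_subset_iff.2 fun k _ =>
    Finset.mem_Icc.2 ⟨one_le_rank X k, rank_le X k⟩) ?_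
  rw [Finset.card_image_of_injective _ (rank_injective hX), Nat.card_Icc, Finset.card_univ,
    Fintype.card_fin, Nat.add_sub_cancel]

theorem exists_rank_eq (hX : Function.Injective X) {r : ℕ} (h1 : 1 ≤ r) (hr : r ≤ n) :
    ∃ k, rank X k = r := by
  have hmem : r ∈ Finset.univ.image (rank X) := by
    rw [image_rank hX]
    exact Finset.mem_Icc.2 ⟨h1, hr⟩
  simpa only [Finset.mem_image, Finset.mem_univ, true_and] using hmem

end Rank

section TrimmedMean

variable {α : ℝ} {X : Fin n → ℝ}

theorem expect_weight_rank (hX : Function.Injective X) (hm : 2 * trimCount n α < n) :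
    𝔼 k, weight n α (rank X k) = 1 := by
  have hn : (n : ℝ) ≠ 0 := Nat.cast_ne_zero.2 (pos_of_gt hm).ne'
  have hkept : (Finset.Icc 1 n).filter (fun r => trimCount n α + 1 ≤ r ∧ r + trimCount n α ≤ n)
      = Finset.Icc (trimCount n α + 1) (n - trimCount n α) := by
    ext r
    simp only [Finset.mem_filter, Finset.mem_Icc]
    omega
  have hcard : (Finset.Icc (trimCount n α + 1) (n - trimCount n α)).card
      = n - 2 * trimCount n α := by
    rw [Nat.card_Icc]
    omega
  have hsum : ∑ k, weight n α (rank X k) = ∑ r ∈ Finset.Icc 1 n, weight n α r := by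
    rw [← image_rank hX, Finset.sum_image fun i _ j _ h => rank_injective hX h]
  have hkept_ne : (n - 2 * trimCount n α : ℝ) ≠ 0 := sub_ne_zero.2 (by exact_mod_cast hm.ne')
  rw [Fintype.expect_eq_sum_div_card, Fintype.card_fin, hsum]
  simp only [weight_natCast]
  rw [← Finset.sum_filter, hkept, Finset.sum_const, hcard, nsmul_eq_mul, Nat.cast_sub hm.le,
    Nat.cast_mul, Nat.cast_two]
  field_simp

theorem trimmedMean_eq_expect (X : Fin n → ℝ) (hm : 2 * trimCount n α < n) :
    trimmedMean α X = 𝔼 k, weight n α (rank X k) * X k := by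
  have hn : (n : ℝ) ≠ 0 := Nat.cast_ne_zero.2 (pos_of_gt hm).ne'
  have hkept_ne : (n - 2 * trimCount n α : ℝ) ≠ 0 := sub_ne_zero.2 (by exact_mod_cast hm.ne')
  rw [Fintype.expect_eq_sum_div_card, Fintype.card_fin, trimmedMean, Finset.sum_div]
  refine Finset.sum_congr rfl fun k _ => ?_
  rw [weight_natCast]
  split_ifs
  · field_simp
  · rw [zero_mul, zero_div]

theorem trimmedMean_lt_of_rank_eq (hn : 2 ≤ n) (hX : Function.Injective X)
    (hm : 2 * trimCount n α < n) {k : Fin n} (hk : rank X k = n) : trimmedMean α X < X k := by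
  obtain ⟨j, hj⟩ := exists_rank_eq hX (r := trimCount n α + 1) (by omega) (by omega)
  have hjk : X j < X k := rank_lt_rank_iff.1 (by omega)
  have hwj : 0 < weight n α (rank X j) := by
    rw [weight_natCast, if_pos (by omega)]
    exact one_div_pos.2 (trimmed_fraction_pos hm)
  have hle : ∀ i, X i ≤ X k := fun i =>
    not_lt.1 fun hlt => ((rank_le X i).trans_eq hk.symm).not_gt (rank_lt_rank_iff.2 hlt)
  calc trimmedMean α X = 𝔼 i, weight n α (rank X i) * X i := trimmedMean_eq_expect X hm
    _ < 𝔼 i, weight n α (rank X i) * X k :=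
      Finset.expect_lt_expect (fun i _ => mul_le_mul_of_nonneg_left (hle i) (weight_nonneg hm _))
        ⟨j, Finset.mem_univ j, mul_lt_mul_of_pos_left hjk hwj⟩
    _ = X k := by rw [← Finset.expect_mul, expect_weight_rank hX hm, one_mul]

end TrimmedMean

/-! ### Concentration of the estimated ranks -/

theorem sum_mul_exp_le {E : Type*} [Fintype E] {p : E → ℝ} (hp : p ∈ stdSimplex ℝ E)
    {Δ : E → ℝ} {b θ d : ℝ} (hb : ∀ x, |Δ x| ≤ b) (hθ : 0 ≤ θ) (hθb : θ * b ≤ 1)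
    (hd : ∑ x, p x * Δ x ≤ -d) :
    ∑ x, p x * Real.exp (θ * Δ x) ≤ 1 - θ * d + (θ * b) ^ 2 := by
  have hexp : ∀ x, Real.exp (θ * Δ x) ≤ 1 + (θ * b) ^ 2 + θ * Δ x := fun x => by
    have habs : |θ * Δ x| ≤ θ * b := by
      rw [abs_mul, abs_of_nonneg hθ]
      exact mul_le_mul_of_nonneg_left (hb x) hθ
    have htaylor := (abs_le.1 (Real.abs_exp_sub_one_sub_id_le (habs.trans hθb))).2
    have hsq := sq_le_sq.2 (habs.trans (le_abs_self _))
    linarith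
  calc ∑ x, p x * Real.exp (θ * Δ x)
      ≤ ∑ x, p x * (1 + (θ * b) ^ 2 + θ * Δ x) :=
        Finset.sum_le_sum fun x _ => mul_le_mul_of_nonneg_left (hexp x) (hp.1 x)
    _ = 1 + (θ * b) ^ 2 + θ * ∑ x, p x * Δ x := by
        simp only [mul_add, Finset.sum_add_distrib, ← Finset.sum_mul, hp.2, one_mul,
          mul_left_comm _ θ, Finset.mul_sum]
    _ ≤ 1 - θ * d + (θ * b) ^ 2 := by linarith [mul_le_mul_of_nonneg_left hd hθ]

theorem pathMean_exp_le_of_drift {E : Type*} [Fintype E] {p : E → ℝ} (hp : p ∈ stdSimplex ℝ E)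
    {Φ : List E → ℝ} {b d : ℝ} (hb0 : 0 < b) (hd0 : 0 ≤ d) (hdb : d ≤ b)
    (hb : ∀ x l, |Φ (x :: l) - Φ l| ≤ b) (hd : transition p Φ ≤ Φ - Function.const _ d) (t : ℕ) :
    pathMean p t (fun l => Real.exp (d / (2 * b ^ 2) * Φ l))
      ≤ (1 - (d / (2 * b)) ^ 2) ^ t * Real.exp (d / (2 * b ^ 2) * Φ []) := by
  set θ := d / (2 * b ^ 2) with hθ
  have hθb : θ * b = d / (2 * b) := by
    rw [hθ]
    field_simp
  have hθd : θ * d = 2 * (d / (2 * b)) ^ 2 := by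
    rw [hθ]
    field_simp
  have hratio : d / (2 * b) ≤ 1 := div_le_one_of_le₀ (by linarith) (by positivity)
  have hρ : 0 ≤ 1 - (d / (2 * b)) ^ 2 :=
    sub_nonneg.2 (pow_le_one₀ (by positivity) hratio)
  refine pathMean_le_pow_mul hp.1 hρ (fun l => ?_) t
  have hdrift : ∑ x, p x * (Φ (x :: l) - Φ l) ≤ -d := by
    have hdl : ∑ x, p x * Φ (x :: l) ≤ Φ l - d := hd l
    simp only [mul_sub, Finset.sum_sub_distrib, ← Finset.sum_mul, hp.2, one_mul]
    linarith
  calc ∑ x, p x * Real.exp (θ * Φ (x :: l))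
      = (∑ x, p x * Real.exp (θ * (Φ (x :: l) - Φ l))) * Real.exp (θ * Φ l) := by
        rw [Finset.sum_mul]
        refine Finset.sum_congr rfl fun x _ => ?_
        rw [mul_assoc, ← Real.exp_add]
        ring_nf
    _ ≤ (1 - θ * d + (θ * b) ^ 2) * Real.exp (θ * Φ l) :=
        mul_le_mul_of_nonneg_right (sum_mul_exp_le hp (fun x => hb x l) (by positivity)
          (hθb.trans_le hratio) hdrift) (Real.exp_pos _).le
    _ = (1 - (d / (2 * b)) ^ 2) * Real.exp (θ * Φ l) := by
        rw [hθb, hθd]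
        ring

theorem abs_dotProduct_le_sum_abs {ι : Type*} [Fintype ι] (u : ι → ℝ) {w : ι → ℝ}
    (hw : ∀ j, |w j| ≤ 1) : |u ⬝ᵥ w| ≤ ∑ j, |u j| :=
  (Finset.abs_sum_le_sum_abs _ _).trans <| Finset.sum_le_sum fun j _ => by
    rw [abs_mul]
    exact mul_le_of_le_one_right (abs_nonneg _) (hw j)

/-- The signed accumulated error `ε (C_k - 1) (R'_k - (r_k - 1) / n)` of the rank estimate of node
`k`, in excess of the tolerance `1 / (2 n)` per refreshment. -/
def excess (mode : Schedule) (α : ℝ) (X : Fin n → ℝ) (k : Fin n) (ε : ℝ)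
    (l : List (Sym2 (Fin n))) : ℝ :=
  (((stateAfter mode α X l).count k : ℝ) - 1)
    * (ε * ((stateAfter mode α X l).normRank k - normalizedRank X k) - 1 / (2 * n))

/-- The excess, compensated by a linear functional of the positions of the observations below `X_k`.
When `u` solves the Poisson equation `L(P) u = e_k - 1 / n`, its drift is constant. -/
def compensatedExcess (mode : Schedule) (p : Sym2 (Fin n) → ℝ) (α : ℝ) (X : Fin n → ℝ) (k : Fin n)
    (ε : ℝ) (u : Fin n → ℝ) (l : List (Sym2 (Fin n))) : ℝ :=
  excess mode α X k ε l + ε * refreshProb mode p k * (u ⬝ᵥ (stateAfter mode α X l).below (X k))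

section Concentration

variable {mode : Schedule} {p : Sym2 (Fin n) → ℝ} {α ε : ℝ} {X u : Fin n → ℝ} {k : Fin n}

theorem excess_nil : excess mode α X k ε [] = 0 := by
  simp [excess, stateAfter, State.init]

theorem excess_cons (x : Sym2 (Fin n)) (l : List (Sym2 (Fin n))) :
    excess mode α X k ε (x :: l) = excess mode α X k ε l + activity mode k x
      * (ε * ((stateAfter mode α X l).below (X k) k - normalizedRank X k) - 1 / (2 * n)) := by
  have hcount := count_cons mode α X k x l
  have hrank := count_sub_one_mul_normRank_cons mode α X k x l
  unfold excess
  rw [hcount] at hrank ⊢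
  linear_combination ε * hrank

theorem excess_nonneg_of_wt_ne {l : List (Sym2 (Fin n))}
    (hw : (stateAfter mode α X l).wt k ≠ weight n α (rank X k)) :
    0 ≤ excess mode α X k 1 l ∨ 0 ≤ excess mode α X k (-1) l := by
  have hn : (0 : ℝ) < n := Nat.cast_pos.2 k.pos
  have hcount : (0 : ℝ) ≤ ((stateAfter mode α X l).count k : ℝ) - 1 :=
    sub_nonneg.2 (Nat.one_le_cast.2 (one_le_count mode α X k l))
  rcases wt_eq_weight mode α X k l with hunrefreshed | hwt
  · left
    simp only [excess, hunrefreshed, Nat.cast_one, sub_self, zero_mul, le_refl]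
  have hfar : 1 / 2 ≤ |n * (stateAfter mode α X l).normRank k + 1 - rank X k| := by
    by_contra! hnear
    exact hw (hwt.trans (weight_eq_of_abs_sub_lt hnear))
  have hscale : n * (stateAfter mode α X l).normRank k + 1 - rank X k
      = n * ((stateAfter mode α X l).normRank k - normalizedRank X k) := by
    rw [normalizedRank]
    field_simp
    ring
  rw [hscale, abs_mul, abs_of_pos hn, ← div_le_iff₀' hn, div_div] at hfar
  exact (le_abs.1 hfar).imp (fun h => mul_nonneg hcount (by linarith))
    fun h => mul_nonneg hcount (by linarith)

theorem sq_wt_sub_le (hm : 2 * trimCount n α < n) {θ : ℝ} (hθ : 0 ≤ θ)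
    (l : List (Sym2 (Fin n))) :
    ((stateAfter mode α X l).wt k - weight n α (rank X k)) ^ 2
      ≤ (n : ℝ) ^ 2 * (Real.exp (θ * excess mode α X k 1 l)
        + Real.exp (θ * excess mode α X k (-1) l)) := by
  by_cases hw : (stateAfter mode α X l).wt k = weight n α (rank X k)
  · rw [hw, sub_self, zero_pow two_ne_zero]
    positivity
  have hsq : ((stateAfter mode α X l).wt k - weight n α (rank X k)) ^ 2 ≤ (n : ℝ) ^ 2 :=
    sq_le_sq' (by linarith [wt_nonneg mode X hm k l, weight_le hm (rank X k)])
      (by linarith [wt_le mode X hm k l, weight_nonneg hm (rank X k)])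
  refine hsq.trans (le_mul_of_one_le_right (sq_nonneg _) ?_)
  rcases excess_nonneg_of_wt_ne hw with h | h
  · exact (Real.one_le_exp (mul_nonneg hθ h)).trans (le_add_of_nonneg_right (Real.exp_pos _).le)
  · exact (Real.one_le_exp (mul_nonneg hθ h)).trans (le_add_of_nonneg_left (Real.exp_pos _).le)

theorem sum_mul_dotProduct_below_sub (u : Fin n → ℝ) (l : List (Sym2 (Fin n))) :
    ∑ x, p x * (u ⬝ᵥ (stateAfter mode α X (x :: l)).below (X k)
        - u ⬝ᵥ (stateAfter mode α X l).below (X k))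
      = -(weightedLaplacian p *ᵥ u ⬝ᵥ (stateAfter mode α X l).below (X k)) := by
  rw [weightedLaplacian_mulVec_dotProduct, weightedLaplacian_mulVec, dotProduct_sum,
    ← Finset.sum_neg_distrib]
  refine Finset.sum_congr rfl fun x _ => ?_
  rw [below_stateAfter_cons, dotProduct_smul, dotProduct_sub, smul_eq_mul]
  ring

theorem compensatedExcess_cons_sub (x : Sym2 (Fin n)) (l : List (Sym2 (Fin n))) :
    compensatedExcess mode p α X k ε u (x :: l) - compensatedExcess mode p α X k ε u l
      = activity mode k x
          * (ε * ((stateAfter mode α X l).below (X k) k - normalizedRank X k) - 1 / (2 * n))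
        + ε * refreshProb mode p k * (u ⬝ᵥ (stateAfter mode α X (x :: l)).below (X k)
          - u ⬝ᵥ (stateAfter mode α X l).below (X k)) := by
  rw [compensatedExcess, compensatedExcess, excess_cons]
  ring

theorem transition_compensatedExcess (hp : ∑ x, p x = 1)
    (hu : weightedLaplacian p *ᵥ u = Pi.single k 1 - Function.const _ (1 / n : ℝ)) :
    transition p (compensatedExcess mode p α X k ε u)
      = compensatedExcess mode p α X k ε u
        - Function.const _ (refreshProb mode p k / (2 * n)) := by
  ext l
  have hpoisson : weightedLaplacian p *ᵥ u ⬝ᵥ (stateAfter mode α X l).below (X k)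
      = (stateAfter mode α X l).below (X k) k - normalizedRank X k := by
    rw [hu, sub_dotProduct, single_one_dotProduct, ← expect_below_stateAfter mode α X k l,
      Fintype.expect_eq_sum_div_card, Fintype.card_fin]
    simp only [dotProduct, Function.const_apply, one_div_mul_eq_div, Finset.sum_div]
  have hsplit : ∀ (a c : ℝ) (D : Sym2 (Fin n) → ℝ),
      ∑ x, p x * (activity mode k x * a + c * D x)
        = refreshProb mode p k * a + c * ∑ x, p x * D x := fun a c D => by
    rw [refreshProb, Finset.sum_mul, Finset.mul_sum, ← Finset.sum_add_distrib]
    exact Finset.sum_congr rfl fun x _ => by ring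
  have hdrift : ∑ x, p x * (compensatedExcess mode p α X k ε u (x :: l)
      - compensatedExcess mode p α X k ε u l) = -(refreshProb mode p k / (2 * n)) := by
    simp only [compensatedExcess_cons_sub]
    rw [hsplit, sum_mul_dotProduct_below_sub, hpoisson]
    ring
  simp only [mul_sub, Finset.sum_sub_distrib, ← Finset.sum_mul, hp, one_mul] at hdrift
  rw [transition_apply, Pi.sub_apply, Function.const_apply]
  linarith

theorem abs_mul_dotProduct_le (hε : |ε| ≤ 1) {π : ℝ} (hπ0 : 0 ≤ π) (hπ1 : π ≤ 1)
    (u : Fin n → ℝ) {w : Fin n → ℝ} (hw : ∀ j, |w j| ≤ 1) :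
    |ε * π * (u ⬝ᵥ w)| ≤ ∑ j, |u j| := by
  rw [abs_mul, abs_mul, abs_of_nonneg hπ0]
  exact (mul_le_of_le_one_left (abs_nonneg _) (mul_le_one₀ hε hπ0 hπ1)).trans
    (abs_dotProduct_le_sum_abs u hw)

theorem abs_compensatedExcess_cons_sub_le (hp : p ∈ stdSimplex ℝ (Sym2 (Fin n))) (hε : |ε| ≤ 1)
    (x : Sym2 (Fin n)) (l : List (Sym2 (Fin n))) :
    |compensatedExcess mode p α X k ε u (x :: l) - compensatedExcess mode p α X k ε u l|
      ≤ 2 + ∑ j, |u j| := by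
  have htol : |1 / (2 * n : ℝ)| ≤ 1 := by
    have hn : (1 : ℝ) ≤ n := Nat.one_le_cast.2 k.pos
    rw [abs_of_nonneg (by positivity), div_le_one (by positivity)]
    linarith
  have hdev : |(stateAfter mode α X l).below (X k) k - normalizedRank X k| ≤ 1 :=
    abs_sub_le_of_nonneg_of_le (State.below_nonneg ..) (State.below_le_one ..)
      (normalizedRank_nonneg X k) (normalizedRank_le_one X k)
  have hrefresh : |ε * ((stateAfter mode α X l).below (X k) k - normalizedRank X k)
      - 1 / (2 * n)| ≤ 2 := by
    refine (abs_sub _ _).trans ?_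
    rw [abs_mul]
    linarith [mul_le_one₀ hε (abs_nonneg _) hdev]
  rw [compensatedExcess_cons_sub, ← dotProduct_sub]
  refine (abs_add_le _ _).trans (add_le_add ?_ (abs_mul_dotProduct_le hε
    (refreshProb_nonneg hp mode k) (refreshProb_le_one hp mode k) u fun j => ?_))
  · rw [abs_mul, abs_of_nonneg (activity_nonneg mode k x)]
    exact (mul_le_of_le_one_left (abs_nonneg _) (activity_le_one mode k x)).trans hrefresh
  · exact abs_sub_le_of_nonneg_of_le (State.below_nonneg ..) (State.below_le_one ..)
      (State.below_nonneg ..) (State.below_le_one ..)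

theorem abs_compensatedExcess_sub_excess_le (hp : p ∈ stdSimplex ℝ (Sym2 (Fin n)))
    (hε : |ε| ≤ 1) (l : List (Sym2 (Fin n))) :
    |compensatedExcess mode p α X k ε u l - excess mode α X k ε l| ≤ ∑ j, |u j| := by
  rw [compensatedExcess, add_sub_cancel_left]
  refine abs_mul_dotProduct_le hε (refreshProb_nonneg hp mode k) (refreshProb_le_one hp mode k) u
    fun j => ?_
  rw [abs_of_nonneg (State.below_nonneg ..)]
  exact State.below_le_one ..

theorem refreshProb_div_le_one (hp : p ∈ stdSimplex ℝ (Sym2 (Fin n))) (mode : Schedule)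
    (k : Fin n) : refreshProb mode p k / (2 * n) ≤ 1 := by
  have hn : (1 : ℝ) ≤ n := Nat.one_le_cast.2 k.pos
  exact div_le_one_of_le₀ ((refreshProb_le_one hp mode k).trans (by linarith)) (by positivity)

theorem pathMean_exp_excess_le (hp : p ∈ stdSimplex ℝ (Sym2 (Fin n)))
    (hu : weightedLaplacian p *ᵥ u = Pi.single k 1 - Function.const _ (1 / n : ℝ)) (hε : |ε| ≤ 1)
    {b d : ℝ} (hb : b = 2 + ∑ j, |u j|) (hd : d = refreshProb mode p k / (2 * n)) (t : ℕ) :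
    pathMean p t (fun l => Real.exp (d / (2 * b ^ 2) * excess mode α X k ε l))
      ≤ Real.exp 2 * (1 - (d / (2 * b)) ^ 2) ^ t := by
  have hU : 0 ≤ ∑ j, |u j| := Finset.sum_nonneg fun j _ => abs_nonneg _
  have hb0 : 0 < b := by linarith
  have hd0 : 0 ≤ d := hd ▸ div_nonneg (refreshProb_nonneg hp mode k) (by positivity)
  have hd1 : d ≤ 1 := hd ▸ refreshProb_div_le_one hp mode k
  set θ := d / (2 * b ^ 2) with hθ
  have hθ0 : 0 ≤ θ := by positivity
  have hθb : θ * b ≤ 1 := by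
    rw [hθ, div_mul_eq_mul_div]
    exact div_le_one_of_le₀ (by nlinarith) (by positivity)
  have hρ : 0 ≤ 1 - (d / (2 * b)) ^ 2 := sub_nonneg.2 <| pow_le_one₀ (by positivity) <|
    div_le_one_of_le₀ (by linarith) (by positivity)
  have hcompensation : ∀ l,
      |θ * compensatedExcess mode p α X k ε u l - θ * excess mode α X k ε l| ≤ 1 := fun l => by
    rw [← mul_sub, abs_mul, abs_of_nonneg hθ0]
    exact (mul_le_mul_of_nonneg_left ((abs_compensatedExcess_sub_excess_le hp hε l).trans
      (by linarith)) hθ0).trans hθb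
  have hcompensated := pathMean_exp_le_of_drift (Φ := compensatedExcess mode p α X k ε u) hp hb0
    hd0 (by linarith) (fun x l => hb ▸ abs_compensatedExcess_cons_sub_le hp hε x l)
    (hd ▸ (transition_compensatedExcess hp.2 hu).le) t
  calc pathMean p t (fun l => Real.exp (θ * excess mode α X k ε l))
      ≤ pathMean p t
          (Real.exp 1 • fun l => Real.exp (θ * compensatedExcess mode p α X k ε u l)) := by
        refine pathMean_mono hp.1 t fun l => ?_
        rw [Pi.smul_apply, smul_eq_mul, ← Real.exp_add]
        exact Real.exp_le_exp.2 (by linarith [(abs_le.1 (hcompensation l)).1])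
    _ ≤ Real.exp 1 * ((1 - (d / (2 * b)) ^ 2) ^ t * Real.exp 1) := by
        rw [map_smul, smul_eq_mul]
        refine mul_le_mul_of_nonneg_left (hcompensated.trans ?_) (Real.exp_pos _).le
        refine mul_le_mul_of_nonneg_left (Real.exp_le_exp.2 ?_) (pow_nonneg hρ t)
        simpa only [excess_nil, mul_zero, sub_zero] using (abs_le.1 (hcompensation [])).2
    _ = Real.exp 2 * (1 - (d / (2 * b)) ^ 2) ^ t := by
        rw [mul_left_comm, ← Real.exp_add, one_add_one_eq_two, mul_comm]

end Concentration

section UniformConcentration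

variable {G : SimpleGraph (Fin n)} {p : Sym2 (Fin n) → ℝ}

theorem exists_pathMean_sq_wt_sub_le (hn : 2 ≤ n) (hG : G.Connected) (hp : IsEdgeLaw G p)
    (mode : Schedule) (k : Fin n) :
    ∃ B ρ : ℝ, 0 ≤ B ∧ 0 ≤ ρ ∧ ρ < 1 ∧ ∀ (α : ℝ) (X : Fin n → ℝ), 2 * trimCount n α < n → ∀ t,
      pathMean p t (fun l => ((stateAfter mode α X l).wt k - weight n α (rank X k)) ^ 2)
        ≤ B * ρ ^ t := by
  obtain ⟨u, hu⟩ := exists_weightedLaplacian_mulVec_eq hG hp k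
  obtain ⟨b, hb⟩ : ∃ b, b = 2 + ∑ j, |u j| := ⟨_, rfl⟩
  obtain ⟨d, hd⟩ : ∃ d, d = refreshProb mode p k / (2 * n) := ⟨_, rfl⟩
  have hb2 : 2 ≤ b := hb ▸ le_add_of_nonneg_right (Finset.sum_nonneg fun j _ => abs_nonneg _)
  have hd0 : 0 < d := hd ▸ div_pos (refreshProb_pos hn hG hp mode k) (by positivity)
  have hd1 : d ≤ 1 := hd ▸ refreshProb_div_le_one hp.mem_stdSimplex mode k
  have hratio : d / (2 * b) ≤ 1 := div_le_one_of_le₀ (by linarith) (by linarith)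
  refine ⟨2 * n ^ 2 * Real.exp 2, 1 - (d / (2 * b)) ^ 2, by positivity,
    sub_nonneg.2 (pow_le_one₀ (by positivity) hratio), sub_lt_self _ (by positivity),
    fun α X hm t => ?_⟩
  calc _ ≤ pathMean p t (((n : ℝ) ^ 2) • (
          (fun l => Real.exp (d / (2 * b ^ 2) * excess mode α X k 1 l)) +
            fun l => Real.exp (d / (2 * b ^ 2) * excess mode α X k (-1) l))) :=
        pathMean_mono hp.nonneg t fun l => sq_wt_sub_le hm (by positivity) l
    _ ≤ (n : ℝ) ^ 2 * (Real.exp 2 * (1 - (d / (2 * b)) ^ 2) ^ t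
          + Real.exp 2 * (1 - (d / (2 * b)) ^ 2) ^ t) := by
        rw [map_smul, map_add, smul_eq_mul]
        gcongr
        exacts [pathMean_exp_excess_le hp.mem_stdSimplex hu (by simp) hb hd t,
          pathMean_exp_excess_le hp.mem_stdSimplex hu (by simp) hb hd t]
    _ = 2 * n ^ 2 * Real.exp 2 * (1 - (d / (2 * b)) ^ 2) ^ t := by ring

theorem exists_pathMean_sum_sq_wt_sub_le (hn : 2 ≤ n) (hG : G.Connected) (hp : IsEdgeLaw G p)
    (mode : Schedule) :
    ∃ B ρ : ℝ, 0 ≤ B ∧ 0 ≤ ρ ∧ ρ < 1 ∧ ∀ (α : ℝ) (X : Fin n → ℝ), 2 * trimCount n α < n → ∀ t,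
      pathMean p t (fun l => ∑ k, ((stateAfter mode α X l).wt k - weight n α (rank X k)) ^ 2)
        ≤ B * ρ ^ t := by
  choose B ρ hB hρ0 hρ1 hle using exists_pathMean_sq_wt_sub_le hn hG hp mode
  have := Fin.nontrivial_iff_two_le.2 hn
  obtain ⟨j, hj⟩ := Finite.exists_max ρ
  refine ⟨∑ k, B k, ρ j, Finset.sum_nonneg fun k _ => hB k, hρ0 j, hρ1 j, fun α X hm t => ?_⟩
  rw [← Finset.sum_fn, map_sum, Finset.sum_mul]
  refine Finset.sum_le_sum fun k _ => (hle k α X hm t).trans ?_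
  exact mul_le_mul_of_nonneg_left (pow_le_pow_left₀ (hρ0 k) (hj k) t) (hB k)

end UniformConcentration

/-! ### The error of the estimate -/

theorem l2norm_sq (v : Fin n → ℝ) : l2norm v ^ 2 = ∑ k, v k ^ 2 := by
  simp [l2norm, EuclideanSpace.real_norm_sq_eq]

theorem l2norm_nonneg (v : Fin n → ℝ) : 0 ≤ l2norm v := norm_nonneg _

theorem abs_le_l2norm (v : Fin n → ℝ) (k : Fin n) : |v k| ≤ l2norm v :=
  PiLp.norm_apply_le (WithLp.toLp 2 v) k

/-- The estimate `Z` after the edges of the history `l`. -/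
def estimateAfter (mode : Schedule) (α : ℝ) (X : Fin n → ℝ) (l : List (Sym2 (Fin n)))
    (k : Fin n) : ℝ :=
  (stateAfter mode α X l).num k / max 1 ((stateAfter mode α X l).mass k)

theorem IsEdgeSampling.integral_estimate {Ω : Type*} [MeasurableSpace Ω] {μ : Measure Ω}
    {p : Sym2 (Fin n) → ℝ} (hp : ∀ e, 0 ≤ p e) {e : ℕ → Ω → Sym2 (Fin n)}
    (he : IsEdgeSampling μ p e) (mode : Schedule) (α : ℝ) (X : Fin n → ℝ) (t : ℕ)
    (f : (Fin n → ℝ) → ℝ) :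
    ∫ ω, f (estimate mode α X (fun s => e s ω) t) ∂μ
      = pathMean p t fun l => f (estimateAfter mode α X l) := by
  rw [← he.integral_history hp]
  refine integral_congr_ae (.of_forall fun ω => congrArg f ?_)
  ext k
  rw [estimate, run_eq_stateAfter_history, estimateAfter]

theorem sq_div_max_sub_le (N M z : ℝ) :
    (N / max 1 M - z) ^ 2 ≤ 2 * (N - z) ^ 2 + 2 * z ^ 2 * (M - 1) ^ 2 := by
  set D := max 1 M
  have hD : 1 ≤ D := le_max_left 1 M
  have hD_sub : |D - 1| ≤ |M - 1| := by
    have hlip := abs_max_sub_max_le_abs M 1 1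
    rwa [max_self, max_comm] at hlip
  have hsplit : N / D - z = ((N - z) - z * (D - 1)) / D := by
    field_simp
    ring
  calc (N / D - z) ^ 2 ≤ ((N - z) - z * (D - 1)) ^ 2 := by
        rw [hsplit, div_pow]
        exact div_le_self (sq_nonneg _) (one_le_pow₀ hD)
    _ ≤ 2 * ((N - z) ^ 2 + (z * (D - 1)) ^ 2) := by
        linarith [sq_nonneg ((N - z) + z * (D - 1))]
    _ ≤ 2 * ((N - z) ^ 2 + z ^ 2 * (M - 1) ^ 2) := by
        rw [mul_pow]
        gcongr 2 * (_ + _ * ?_)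
        exact sq_le_sq.2 hD_sub
    _ = 2 * (N - z) ^ 2 + 2 * z ^ 2 * (M - 1) ^ 2 := by ring

theorem weight_rank_eq_zero_of_trimmed {α : ℝ} {X : Fin n → ℝ} {k : Fin n} (hk : rank X k = 1)
    (hm : 1 ≤ trimCount n α) : weight n α (rank X k) = 0 := by
  rw [weight_natCast, if_neg (by omega)]

theorem wt_eq_zero_of_trimmed (mode : Schedule) {α : ℝ} {X : Fin n → ℝ} {k : Fin n}
    (hk : rank X k = 1) (hm : 1 ≤ trimCount n α) (l : List (Sym2 (Fin n))) :
    (stateAfter mode α X l).wt k = 0 := by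
  have hweight := weight_rank_eq_zero_of_trimmed hk hm
  rw [hk, Nat.cast_one] at hweight
  induction l with
  | nil => rfl
  | cons x l ih =>
    have hR := normRank_eq_zero mode α X hk (x :: l)
    simp only [stateAfter_cons, step] at hR ⊢
    rw [hR, mul_zero, zero_add, hweight, ih, ite_self]

/-- `S` bounds the trimmed mean and every observation that influences the estimate: a trimmed
observation of rank one never gets a nonzero weight. -/
structure IsScale (α : ℝ) (X : Fin n → ℝ) (S : ℝ) : Prop where
  abs_trimmedMean_le : |trimmedMean α X| ≤ S
  abs_le_or_trimmed : ∀ k, |X k| ≤ S ∨ rank X k = 1 ∧ 1 ≤ trimCount n α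

section Error

variable {α S : ℝ} {X : Fin n → ℝ}

theorem IsScale.sum_sq_wt_mul_sub_le (hS : IsScale α X S) (mode : Schedule)
    (l : List (Sym2 (Fin n))) :
    ∑ k, ((stateAfter mode α X l).wt k * X k - weight n α (rank X k) * X k) ^ 2
      ≤ S ^ 2 * ∑ k, ((stateAfter mode α X l).wt k - weight n α (rank X k)) ^ 2 := by
  rw [Finset.mul_sum]
  refine Finset.sum_le_sum fun k _ => ?_
  rcases hS.abs_le_or_trimmed k with hk | ⟨hk, hm⟩
  · rw [← sub_mul, mul_pow, mul_comm]
    exact mul_le_mul_of_nonneg_right (sq_le_sq.2 (hk.trans (le_abs_self S))) (sq_nonneg _)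
  · simp [wt_eq_zero_of_trimmed mode hk hm, weight_rank_eq_zero_of_trimmed hk hm]

theorem IsScale.sq_l2norm_le (hS : IsScale α X S) (N M : Fin n → ℝ) :
    l2norm (fun k => N k / max 1 (M k) - trimmedMean α X) ^ 2
      ≤ 2 * ∑ k, (N k - trimmedMean α X) ^ 2 + 2 * S ^ 2 * ∑ k, (M k - 1) ^ 2 := by
  have hz : trimmedMean α X ^ 2 ≤ S ^ 2 :=
    sq_le_sq.2 (hS.abs_trimmedMean_le.trans (le_abs_self S))
  rw [l2norm_sq, Finset.mul_sum, Finset.mul_sum, ← Finset.sum_add_distrib]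
  refine Finset.sum_le_sum fun k _ => (sq_div_max_sub_le _ _ _).trans ?_
  gcongr

theorem exists_pathMean_sq_l2norm_le {G : SimpleGraph (Fin n)} {p : Sym2 (Fin n) → ℝ}
    (hn : 2 ≤ n) (hG : G.Connected) (hp : IsEdgeLaw G p) (mode : Schedule) :
    ∃ A r : ℝ, 0 ≤ A ∧ 0 ≤ r ∧ r < 1 ∧ ∀ (α : ℝ) (X : Fin n → ℝ) (S : ℝ),
      2 * trimCount n α < n → Function.Injective X → IsScale α X S →
      ∀ t, pathMean p t
          (fun l => l2norm (fun k => estimateAfter mode α X l k - trimmedMean α X) ^ 2)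
        ≤ A * r ^ t * S ^ 2 := by
  obtain ⟨B, ρ, hB, hρ0, hρ1, hwt⟩ := exists_pathMean_sum_sq_wt_sub_le hn hG hp mode
  obtain ⟨K, r, hK, hr0, hr1, htrack⟩ := exists_pathMean_sum_sub_sq_le hG hp hρ0 hρ1
  refine ⟨4 * K * B, r, by positivity, hr0.le, hr1, fun α X S hm hX hS t => ?_⟩
  let s := stateAfter mode α X
  let w : Fin n → ℝ := fun k => weight n α (rank X k)
  have hwt_mul : ∀ t, pathMean p t (fun l => ∑ k, ((s l).wt k * X k - w k * X k) ^ 2)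
      ≤ S ^ 2 * B * ρ ^ t := fun t => by
    calc _ ≤ pathMean p t (S ^ 2 • fun l => ∑ k, ((s l).wt k - w k) ^ 2) :=
          pathMean_mono hp.nonneg t fun l => hS.sum_sq_wt_mul_sub_le mode l
      _ ≤ S ^ 2 * B * ρ ^ t := by
          rw [map_smul, smul_eq_mul, mul_assoc]
          exact mul_le_mul_of_nonneg_left (hwt α X hm t) (sq_nonneg S)
  have hnum := htrack _ _ (fun k => w k * X k) _ (isTracking_num mode α X) (zero_mul X)
    (by positivity) hwt_mul t
  have hmass := htrack _ _ w _ (isTracking_mass mode α X) rfl hB (hwt α X hm) t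
  rw [← trimmedMean_eq_expect X hm] at hnum
  rw [expect_weight_rank hX hm] at hmass
  calc _ ≤ pathMean p t ((2 : ℝ) • (fun l => ∑ k, ((s l).num k - trimmedMean α X) ^ 2)
        + (2 * S ^ 2) • fun l => ∑ k, ((s l).mass k - 1) ^ 2) :=
        pathMean_mono hp.nonneg t fun l => hS.sq_l2norm_le (s l).num (s l).mass
    _ ≤ 2 * (K * (S ^ 2 * B) * r ^ t) + 2 * S ^ 2 * (K * B * r ^ t) := by
        rw [map_add, map_smul, map_smul, smul_eq_mul, smul_eq_mul]
        gcongr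
    _ = 4 * K * B * r ^ t * S ^ 2 := by ring

theorem exists_pathMean_l2norm_le {G : SimpleGraph (Fin n)} {p : Sym2 (Fin n) → ℝ}
    (hn : 2 ≤ n) (hG : G.Connected) (hp : IsEdgeLaw G p) (mode : Schedule) :
    ∃ A r : ℝ, 0 ≤ r ∧ r < 1 ∧ ∀ (α : ℝ) (X : Fin n → ℝ) (S : ℝ),
      2 * trimCount n α < n → Function.Injective X → IsScale α X S →
      ∀ t, pathMean p t (fun l => l2norm fun k => estimateAfter mode α X l k - trimmedMean α X)
        ≤ A * r ^ t * S := by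
  obtain ⟨A, r, hA, hr0, hr1, hle⟩ := exists_pathMean_sq_l2norm_le hn hG hp mode
  refine ⟨√A, √r, r.sqrt_nonneg, (Real.sqrt_lt_sqrt hr0 hr1).trans_eq Real.sqrt_one,
    fun α X S hm hX hS t => ?_⟩
  have hS0 : 0 ≤ S := (abs_nonneg _).trans hS.abs_trimmedMean_le
  refine le_of_sq_le_sq ((sq_pathMean_le hp.mem_stdSimplex t _).trans ?_) (by positivity)
  calc _ ≤ A * r ^ t * S ^ 2 := hle α X S hm hX hS t
    _ = (√A * √r ^ t * S) ^ 2 := by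
      rw [mul_pow, mul_pow, Real.sq_sqrt hA, pow_right_comm, Real.sq_sqrt hr0]

end Error

/-! ### Lower bounds for the vector `K` -/

section Scale

variable {α : ℝ}

theorem gamma_pos (α : ℝ) (X : Fin n → ℝ) (k : Fin n) : 0 < gamma α X k := by
  have hhalf : ∀ i j : ℤ, (0 : ℝ) < |(i : ℝ) - (j + 1 / 2)| := fun i j => by
    refine abs_pos.2 fun h => ?_
    have hodd : ((2 * i : ℤ) : ℝ) = ((2 * j + 1 : ℤ) : ℝ) := by
      push_cast
      linarith
    have hodd' : 2 * i = 2 * j + 1 := by exact_mod_cast hodd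
    omega
  refine lt_min ?_ ?_
  · simpa [leftEnd] using hhalf (rank X k) (trimCount n α)
  · simpa [rightEnd] using hhalf (rank X k) (n - trimCount n α)

theorem gamma_le (hm : 2 * trimCount n α < n) (X : Fin n → ℝ) (k : Fin n) :
    gamma α X k ≤ n := by
  have hm' : (2 * trimCount n α + 1 : ℝ) ≤ n := by exact_mod_cast hm
  have : (0 : ℝ) ≤ trimCount n α := Nat.cast_nonneg _
  have h1 : (1 : ℝ) ≤ rank X k := Nat.one_le_cast.2 (one_le_rank X k)
  have hrank : (rank X k : ℝ) ≤ n := Nat.cast_le.2 (rank_le X k)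
  refine (min_le_left _ _).trans (abs_le.2 ?_)
  constructor <;> simp only [leftEnd] <;> linarith

theorem one_le_sigma {r : ℝ} (h2 : 2 ≤ r) (hr : r ≤ n) : 1 ≤ sigma n r := by
  have hn : (1 : ℝ) ≤ n := by linarith
  have hn0 : (0 : ℝ) < n := one_pos.trans_le hn
  have hle_sqrt : 1 / (n : ℝ) ≤ √((r - 1) / n * (1 - (r - 1) / n)) := by
    refine Real.le_sqrt_of_sq_le ?_
    have hleft : 1 / (n : ℝ) ≤ (r - 1) / n := by
      gcongr
      linarith
    have hright : 1 / (n : ℝ) ≤ 1 - (r - 1) / n := by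
      rw [div_le_iff₀ hn0, sub_mul, div_mul_cancel₀ _ hn0.ne']
      linarith
    rw [sq]
    exact mul_le_mul hleft hright (by positivity) ((by positivity : 0 ≤ 1 / (n : ℝ)).trans hleft)
  have hle_rpow : (n : ℝ) ≤ (n : ℝ) ^ (3 / 2 : ℝ) := by
    simpa only [Real.rpow_one] using
      Real.rpow_le_rpow_of_exponent_le hn (by norm_num : (1 : ℝ) ≤ 3 / 2)
  calc (1 : ℝ) = n * (1 / n) := (mul_one_div_cancel hn0.ne').symm
    _ ≤ sigma n r := by
      unfold sigma
      gcongr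

theorem one_div_le_kVec (hα0 : 0 ≤ α) (hα : α < 1 / 2) (X : Fin n → ℝ) {k : Fin n}
    (hk : 2 ≤ rank X k) : 1 / (n : ℝ) ≤ kVec α X k := by
  have hsigma : 1 ≤ sigma n (rank X k) :=
    one_le_sigma (by exact_mod_cast hk) (by exact_mod_cast rank_le X k)
  have hsqrt : (1 : ℝ) ≤ √6 := Real.one_le_sqrt.2 (by norm_num)
  have hgamma := gamma_pos α X k
  have hα1 : 0 < 1 - 2 * α := by linarith
  refine div_le_div₀ (by positivity) (one_le_mul_of_one_le_of_one_le hsqrt hsigma)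
    (by positivity) ?_
  calc gamma α X k * (1 - 2 * α) ≤ gamma α X k * 1 := by
        gcongr
        linarith
    _ ≤ n := (mul_one _).trans_le (gamma_le (two_mul_trimCount_lt k.pos hα) X k)

theorem abs_le_mul_l2norm (hα0 : 0 ≤ α) (hα : α < 1 / 2) {X : Fin n → ℝ} {k : Fin n}
    (hk : 2 ≤ rank X k) (y : Fin n → ℝ) : |y k| ≤ n * l2norm fun i => kVec α X i * y i := by
  have hn : (0 : ℝ) < n := Nat.cast_pos.2 k.pos
  have hK := one_div_le_kVec hα0 hα X hk
  rw [← div_le_iff₀' hn]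
  calc |y k| / n = 1 / n * |y k| := by ring
    _ ≤ kVec α X k * |y k| := by gcongr
    _ = |kVec α X k * y k| := by rw [abs_mul, abs_of_nonneg (le_trans (by positivity) hK)]
    _ ≤ l2norm fun i => kVec α X i * y i := abs_le_l2norm (fun i => kVec α X i * y i) k

theorem abs_sub_expect_le {ι : Type*} [Fintype ι] (f : ι → ℝ) (k : ι) {b : ℝ}
    (h : ∀ j, j ≠ k → |f j - 𝔼 i, f i| ≤ b) :
    |f k - 𝔼 i, f i| ≤ (Fintype.card ι - 1) * b := by
  classical
  have hsum : f k - 𝔼 i, f i = -∑ j ∈ Finset.univ.erase k, (f j - 𝔼 i, f i) := by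
    rw [eq_neg_iff_add_eq_zero,
      Finset.add_sum_erase _ (fun j => f j - 𝔼 i, f i) (Finset.mem_univ k)]
    exact Fintype.sum_balance f
  rw [hsum, abs_neg]
  refine (Finset.abs_sum_le_sum_abs _ _).trans ((Finset.sum_le_card_nsmul _ _ b fun j hj =>
    h j (Finset.ne_of_mem_erase hj)).trans_eq ?_)
  have hcard : 1 ≤ Fintype.card ι := Fintype.card_pos_iff.2 ⟨k⟩
  rw [Finset.card_erase_of_mem (Finset.mem_univ k), Finset.card_univ, nsmul_eq_mul,
    Nat.cast_sub hcard, Nat.cast_one]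

theorem trimmedMean_of_trimCount_eq_zero (hm : trimCount n α = 0) (X : Fin n → ℝ) :
    trimmedMean α X = 𝔼 k, X k := by
  simp [trimmedMean, hm, one_le_rank, rank_le, Fintype.expect_eq_sum_div_card, Finset.sum_div]

theorem isScale_l2norm (hn : 2 ≤ n) (hα0 : 0 ≤ α) (hα : α < 1 / 2) {X : Fin n → ℝ}
    (hX : Function.Injective X) :
    IsScale α X (n ^ 2 * l2norm fun k => kVec α X k * (|X k| + |trimmedMean α X|)) := by
  have hn1 : (1 : ℝ) ≤ n := by exact_mod_cast one_le_two.trans hn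
  set z := trimmedMean α X
  set S := l2norm fun k => kVec α X k * (|X k| + |z|)
  have hS : 0 ≤ S := l2norm_nonneg _
  have hle : ∀ k, 2 ≤ rank X k → |X k| + |z| ≤ n * S := fun k hk =>
    (le_abs_self _).trans (abs_le_mul_l2norm hα0 hα hk fun k => |X k| + |z|)
  have hsq : n * S ≤ n ^ 2 * S := by
    gcongr
    exact le_self_pow₀ hn1 two_ne_zero
  obtain ⟨i, hi⟩ := exists_rank_eq hX (r := 2) one_le_two hn
  have hzS : |z| ≤ n * S := by linarith [hle i hi.ge, abs_nonneg (X i)]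
  refine ⟨hzS.trans hsq, fun k => ?_⟩
  rcases (one_le_rank X k).eq_or_lt' with hk | hk
  · refine or_iff_not_imp_right.2 fun htrim => ?_
    have hmean : z = 𝔼 k, X k :=
      trimmedMean_of_trimCount_eq_zero (by_contra fun hm => htrim ⟨hk, Nat.pos_of_ne_zero hm⟩) X
    have hdev := abs_sub_expect_le X k (b := n * S) fun j hj => by
      have hrank : rank X j ≠ rank X k := (rank_injective hX).ne hj
      rw [← hmean]
      exact (abs_sub _ _).trans (hle j (by have := one_le_rank X j; omega))
    rw [← hmean, Fintype.card_fin] at hdev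
    calc |X k| = |X k - z + z| := by rw [sub_add_cancel]
      _ ≤ (n - 1) * (n * S) + n * S := (abs_add_le _ _).trans (add_le_add hdev hzS)
      _ = n ^ 2 * S := by ring
  · exact .inl (by linarith [hle k hk, abs_nonneg z])

theorem l2norm_kVec_mul_pos (hn : 2 ≤ n) (hα0 : 0 ≤ α) (hα : α < 1 / 2) {X : Fin n → ℝ}
    (hX : Function.Injective X) :
    0 < l2norm fun k => kVec α X k * (X k + |trimmedMean α X|) := by
  obtain ⟨k, hk⟩ := exists_rank_eq hX (one_le_two.trans hn) le_rfl
  have hlt := trimmedMean_lt_of_rank_eq hn hX (two_mul_trimCount_lt k.pos hα) hk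
  have hpos : 0 < X k + |trimmedMean α X| := by linarith [neg_abs_le (trimmedMean α X)]
  have hle := abs_le_mul_l2norm hα0 hα (hn.trans_eq hk.symm) fun k => X k + |trimmedMean α X|
  exact pos_of_mul_pos_right ((abs_pos.2 hpos.ne').trans_le hle) n.cast_nonneg

end Scale

theorem exists_forall_mul_pow_le (A : ℝ) {r c d C : ℝ} (hr0 : 0 ≤ r) (hr1 : r < 1) (hc : 0 < c)
    (hd : 0 < d) (hC : 0 < C) :
    ∃ T : ℝ, 0 < T ∧ ∀ t : ℕ, T < t → A * r ^ t ≤ C / (d * √(c * t)) := by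
  have hlim : Filter.Tendsto (fun t : ℕ => A * r ^ t * (d * √(c * t))) Filter.atTop (nhds 0) := by
    have hpow := tendsto_pow_const_mul_const_pow_of_abs_lt_one 1
      ((abs_of_nonneg (sq_nonneg r)).trans_lt (pow_lt_one₀ hr0 hr1 two_ne_zero))
    have hsqrt := (hpow.const_mul c).sqrt.const_mul (A * d)
    rw [mul_zero, Real.sqrt_zero, mul_zero] at hsqrt
    refine hsqrt.congr fun t => ?_
    rw [pow_one, ← mul_assoc, pow_right_comm, Real.sqrt_mul' _ (sq_nonneg _),
      Real.sqrt_sq (pow_nonneg hr0 t)]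
    ring
  obtain ⟨N, hN⟩ := Filter.eventually_atTop.1 (hlim.eventually (gt_mem_nhds hC))
  refine ⟨N + 1, by positivity, fun t ht => ?_⟩
  have ht0 : (0 : ℝ) < t := lt_trans (by positivity) ht
  have htN : N ≤ t := by exact_mod_cast ((lt_add_one _).trans ht).le
  exact (le_div_iff₀ (by positivity)).2 (hN t htN).le

end

end GoTrim

open MeasureTheory GoTrim in
theorem theorem4_general {C : ℝ} (hC : 0 < C) {n : ℕ} (hn : 2 ≤ n) {G : SimpleGraph (Fin n)}
    {p : Sym2 (Fin n) → ℝ} (mode : Schedule) (hG : G.Connected) (hp : IsEdgeLaw G p) :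
    (∀ (α : ℝ) (X : Fin n → ℝ), 0 ≤ α → α < 1 / 2 → Function.Injective X →
      ∃ T : ℝ, 0 < T ∧
        ∀ (Ω : Type*) [MeasurableSpace Ω] (μ : Measure Ω) (e : ℕ → Ω → Sym2 (Fin n)),
          IsEdgeSampling μ p e → ∀ t : ℕ, T < t →
            ∫ ω, l2norm (fun k => estimate mode α X (fun s => e s ω) t k - trimmedMean α X) ∂μ
              ≤ C / (cTilde hn p * √(spectralGap hn p * t))
                * l2norm (fun k => kVec α X k * (X k + |trimmedMean α X|))) ∧
    (∃ T : ℝ, 0 < T ∧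
      ∀ (α : ℝ) (X : Fin n → ℝ), 0 ≤ α → α < 1 / 2 → Function.Injective X →
        ∀ (Ω : Type*) [MeasurableSpace Ω] (μ : Measure Ω) (e : ℕ → Ω → Sym2 (Fin n)),
          IsEdgeSampling μ p e → ∀ t : ℕ, T < t →
            ∫ ω, l2norm (fun k => estimate mode α X (fun s => e s ω) t k - trimmedMean α X) ∂μ
              ≤ C / (cTilde hn p * √(spectralGap hn p * t))
                * l2norm (fun k => kVec α X k * (|X k| + |trimmedMean α X|))) := by
  obtain ⟨A, r, hr0, hr1, herror⟩ := exists_pathMean_l2norm_le hn hG hp mode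
  have hdecay := fun A {C} => exists_forall_mul_pow_le A (C := C) hr0 hr1
    (spectralGap_pos hn hG hp) (cTilde_pos hn hG hp)
  have hm {α : ℝ} (hα : α < 1 / 2) := two_mul_trimCount_lt (two_pos.trans_le hn) hα
  constructor
  · intro α X hα0 hα hX
    set S := n ^ 2 * l2norm fun k => kVec α X k * (|X k| + |trimmedMean α X|)
    have hpos := l2norm_kVec_mul_pos hn hα0 hα hX
    obtain ⟨T, hT, hle⟩ := hdecay (A * S) (mul_pos hC hpos)
    refine ⟨T, hT, fun Ω _ μ e he t ht => ?_⟩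
    rw [he.integral_estimate hp.nonneg mode α X t fun Z => l2norm fun k => Z k - trimmedMean α X]
    calc _ ≤ A * r ^ t * S := herror α X S (hm hα) hX (isScale_l2norm hn hα0 hα hX) t
      _ = A * S * r ^ t := by ring
      _ ≤ _ := (hle t ht).trans_eq (by ring)
  · obtain ⟨T, hT, hle⟩ := hdecay (A * n ^ 2) hC
    refine ⟨T, hT, fun α X hα0 hα hX Ω _ μ e he t ht => ?_⟩
    rw [he.integral_estimate hp.nonneg mode α X t fun Z => l2norm fun k => Z k - trimmedMean α X]
    calc _ ≤ A * r ^ t * _ := herror α X _ (hm hα) hX (isScale_l2norm hn hα0 hα hX) t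
      _ = A * n ^ 2 * r ^ t * _ := by ring
      _ ≤ _ := mul_le_mul_of_nonneg_right (hle t ht) (l2norm_nonneg _)

open MeasureTheory GoTrim in
theorem theorem4 :
    ∃ C : ℝ, 0 < C ∧
      ∀ (n : ℕ) (hn : 2 ≤ n) (G : SimpleGraph (Fin n)) (p : Sym2 (Fin n) → ℝ)
        (mode : Schedule),
        G.Connected → ¬ G.IsBipartite → IsEdgeLaw G p →
        (∀ (α : ℝ) (X : Fin n → ℝ), 0 < α → α < 1 / 2 → Function.Injective X →
          ∃ T : ℝ, 0 < T ∧
            ∀ (Ω : Type*) [MeasurableSpace Ω] (μ : Measure Ω) [IsProbabilityMeasure μ]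
              (e : ℕ → Ω → Sym2 (Fin n)), IsEdgeSampling μ p e →
              ∀ t : ℕ, T < t →
                ∫ ω, l2norm (fun k =>
                    estimate mode α X (fun s => e s ω) t k - trimmedMean α X) ∂μ
                  ≤ C / (cTilde hn p * √(spectralGap hn p * t))
                    * l2norm (fun k => kVec α X k * (X k + |trimmedMean α X|))) ∧
        (∃ T : ℝ, 0 < T ∧
          ∀ (α : ℝ) (X : Fin n → ℝ), 0 < α → α < 1 / 2 → Function.Injective X →
            ∀ (Ω : Type*) [MeasurableSpace Ω] (μ : Measure Ω) [IsProbabilityMeasure μ]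
              (e : ℕ → Ω → Sym2 (Fin n)), IsEdgeSampling μ p e →
              ∀ t : ℕ, T < t →
                ∫ ω, l2norm (fun k =>
                    estimate mode α X (fun s => e s ω) t k - trimmedMean α X) ∂μ
                  ≤ C / (cTilde hn p * √(spectralGap hn p * t))
                    * l2norm (fun k => kVec α X k * (|X k| + |trimmedMean α X|))) := by
  refine ⟨1, one_pos, fun n hn G p mode hG _ hp => ?_⟩
  obtain ⟨hpointwise, T, hT, huniform⟩ := theorem4_general one_pos hn mode hG hp
  exact ⟨fun α X hα0 hα hX => (hpointwise α X hα0.le hα hX).imp fun T hT =>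
      ⟨hT.1, fun Ω _ μ _ => hT.2 Ω μ⟩,
    T, hT, fun α X hα0 hα hX Ω _ μ _ => huniform α X hα0.le hα hX Ω μ⟩
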